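/- Let $\Omega\subset\mathbb R^d$, $d\ge 2$, be a bounded domain (nonempty, open, connected) with smooth boundary, let $N\ge 1$, $\epsilon>0$, $D_1,\dots,D_N>0$ and $z_1,\dots,z_N\in\mathbb R$. Let $c_1,\dots,c_N$ and $\Phi$ be a global classical solution of the Nernst–Planck–Poisson system $$\partial_t c_i = D_i\,\mathrm{div}(\nabla c_i+z_ic_i\nabla\Phi),\quad i=1,\dots,N,\qquad -\epsilon\Delta\Phi=\rho:=\sum_{i=1}^N z_ic_i\qquad\text{in }(0,\infty)\times\Omega$$ with $\partial_n c_i=0$ and $\partial_n\Phi=0$ on $\partial\Omega$ and $\int_\Omega\Phi\,dx=0$. Here classical means the following: $c_i$ is continuous on $[0,\infty)\times\overline\Omega$; $c_i$, $\partial_tc_i$, $\nabla c_i$, $\nabla^2c_i$ are continuous on $(0,\infty)\times\overline\Omega$; $c_i>0$ on $(0,\infty)\times\overline\Omega$; $\Phi,\nabla\Phi$ are continuous on $[0,\infty)\times\overline\Omega$, and $\nabla^2\Phi$ on $(0,\infty)\times\overline\Omega$. Let the initial concentrations be electroneutral, $$\sum_{i=1}^N z_i\bar c_i=0,\qquad \bar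 c_i=\frac1{|\Omega|}\int_\Omega c_i(0)\,dx .$$ Put $D=\min_iD_i$ and $$\mathcal E=\sum_{i=1}^N\int_\Omega c_i\ln\frac{c_i}{\bar c_i}\,dx+\frac\epsilon2\int_\Omega|\nabla\Phi|^2\,dx,\qquad \mathcal D=\sum_{i=1}^ND_i\int_\Omega c_i|\nabla(\ln c_i+z_i\Phi)|^2\,dx,$$ $$\tilde{\mathcal D}=D\left(\sum_{i=1}^N\int_\Omega4|\nabla\sqrt{c_i}|^2\,dx+\int_\Omega\Big(\frac2\epsilon\rho^2+\sum_{i=1}^Nz_i^2c_i|\nabla\Phi|^2\Big)dx\right).$$ Then all integrals in $\mathcal E$ (for $t\ge0$) and in $\mathcal D$, $\tilde{\mathcal D}$ (for $t>0$) converge, $\mathcal E$ is continuous on $[0,\infty)$ and differentiable on $(0,\infty)$, and for every $t>0$ $$\frac{d}{dt}\mathcal E+\mathcal D=0,\qquad\text{and in particular}\qquad \frac{d}{dt}\mathcal E+\tilde{\mathcal D}\le0 .$$ -/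

import Mathlib

open MeasureTheory Set
open scoped ContDiff

noncomputable section

namespace NernstPlanckPoisson

/-- `φ` is a smooth local defining function of `Ω` at `p`, on the open neighbourhood `U` of `p`:
inside `U` the set `Ω` is `{φ < 0}`, and `∇φ(p) ≠ 0`. -/
structure IsLocalDefiningFunction {d : ℕ} (Ω : Set (EuclideanSpace ℝ (Fin d)))
    (p : EuclideanSpace ℝ (Fin d)) (U : Set (EuclideanSpace ℝ (Fin d)))
    (φ : EuclideanSpace ℝ (Fin d) → ℝ) : Prop where
  isOpen : IsOpen U
  mem : p ∈ U
  smooth : ContDiffOn ℝ ∞ φ U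
  zero : φ p = 0
  gradient_ne_zero : gradient φ p ≠ 0
  inter_eq : Ω ∩ U = {x ∈ U | φ x < 0}

/-- A bounded domain (nonempty connected open set) of `ℝᵈ` with smooth boundary. -/
structure IsSmoothBoundedDomain {d : ℕ} (Ω : Set (EuclideanSpace ℝ (Fin d))) : Prop where
  isOpen : IsOpen Ω
  isConnected : IsConnected Ω
  isBounded : Bornology.IsBounded Ω
  smooth_boundary : ∀ p ∈ frontier Ω, ∃ U φ, IsLocalDefiningFunction Ω p U φ

/-- `ν` is the outward unit normal of `Ω` at `p`. -/
def IsOutwardUnitNormal {d : ℕ} (Ω : Set (EuclideanSpace ℝ (Fin d)))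
    (p ν : EuclideanSpace ℝ (Fin d)) : Prop :=
  ∃ U φ, IsLocalDefiningFunction Ω p U φ ∧ ν = ‖gradient φ p‖⁻¹ • gradient φ p

/-- Homogeneous Neumann condition `∂ₙ f = 0` on `∂Ω`, for a function `f` which is `C¹` on the
closure of `Ω`. -/
def NeumannZero {d : ℕ} (Ω : Set (EuclideanSpace ℝ (Fin d)))
    (f : EuclideanSpace ℝ (Fin d) → ℝ) : Prop :=
  ∀ p ∈ frontier Ω, ∀ ν, IsOutwardUnitNormal Ω p ν → fderivWithin ℝ f (closure Ω) p ν = 0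

/-- For every time `t ∈ J` the function `f t` is `Cⁿ` up to the boundary of `Ω`, and its spatial
derivatives of order at most `n` are continuous in `(t, x)` on `J × closure Ω`. -/
def SpatiallyC {d : ℕ} (n : ℕ) (J : Set ℝ) (Ω : Set (EuclideanSpace ℝ (Fin d)))
    (f : ℝ → EuclideanSpace ℝ (Fin d) → ℝ) : Prop :=
  (∀ t ∈ J, ContDiffOn ℝ n (f t) (closure Ω)) ∧
  ∀ k ≤ n, ContinuousOn
    (fun q : ℝ × EuclideanSpace ℝ (Fin d) =>
      iteratedFDerivWithin ℝ k (f q.1) (closure Ω) q.2) (J ×ˢ closure Ω)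

/-- The time derivative of `f` exists on `(0, ∞) × closure Ω` and is continuous there. -/
def TimeC1 {d : ℕ} (Ω : Set (EuclideanSpace ℝ (Fin d)))
    (f : ℝ → EuclideanSpace ℝ (Fin d) → ℝ) : Prop :=
  (∀ t > 0, ∀ x ∈ closure Ω, DifferentiableAt ℝ (fun s => f s x) t) ∧
  ContinuousOn
    (fun q : ℝ × EuclideanSpace ℝ (Fin d) => deriv (fun s => f s q.2) q.1)
    (Ioi 0 ×ˢ closure Ω)

/-- Divergence `∑ⱼ ∂ⱼ Fⱼ` of a vector field on `ℝᵈ`. -/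
def divergence {d : ℕ} (F : EuclideanSpace ℝ (Fin d) → EuclideanSpace ℝ (Fin d))
    (x : EuclideanSpace ℝ (Fin d)) : ℝ :=
  ∑ j, (fderiv ℝ F x (EuclideanSpace.single j 1)) j

/-- Charge density `ρ = ∑ᵢ zᵢ cᵢ`. -/
def chargeDensity {d N : ℕ} (z : Fin N → ℝ) (c : Fin N → ℝ → EuclideanSpace ℝ (Fin d) → ℝ)
    (t : ℝ) (x : EuclideanSpace ℝ (Fin d)) : ℝ :=
  ∑ i, z i * c i t x

/-- `(c, Φ)` is a global classical solution, with positive concentrations for positive times, of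
the Nernst–Planck–Poisson system in `Ω` with diffusivities `Dc`, valences `z` and permittivity `ε`,
under homogeneous Neumann conditions. The initial concentrations are the `c i 0`. -/
structure IsClassicalSolution {d N : ℕ} (Ω : Set (EuclideanSpace ℝ (Fin d)))
    (Dc z : Fin N → ℝ) (ε : ℝ) (c : Fin N → ℝ → EuclideanSpace ℝ (Fin d) → ℝ)
    (Φ : ℝ → EuclideanSpace ℝ (Fin d) → ℝ) : Prop where
  conc_continuous : ∀ i, ContinuousOn
    (fun q : ℝ × EuclideanSpace ℝ (Fin d) => c i q.1 q.2) (Ici 0 ×ˢ closure Ω)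
  conc_spatial : ∀ i, SpatiallyC 2 (Ioi 0) Ω (c i)
  conc_time : ∀ i, TimeC1 Ω (c i)
  conc_pos : ∀ i, ∀ t > 0, ∀ x ∈ closure Ω, 0 < c i t x
  pot_C1 : SpatiallyC 1 (Ici 0) Ω Φ
  pot_C2 : SpatiallyC 2 (Ioi 0) Ω Φ
  nernst_planck : ∀ i, ∀ t > 0, ∀ x ∈ Ω,
    deriv (fun s => c i s x) t =
      Dc i * divergence
        (fun y => gradient (c i t) y + (z i * c i t y) • gradient (Φ t) y) x
  poisson : ∀ t > 0, ∀ x ∈ Ω, -ε * Laplacian.laplacian (Φ t) x = chargeDensity z c t x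
  conc_neumann : ∀ i, ∀ t > 0, NeumannZero Ω (c i t)
  pot_neumann : ∀ t > 0, NeumannZero Ω (Φ t)
  pot_mean_zero : ∀ t ≥ 0, ∫ x in Ω, Φ t x = 0

/-- The mean `c̄ᵢ = |Ω|⁻¹ ∫_Ω cᵢ(0) dx` of the initial concentration. -/
def initialMean {d N : ℕ} (Ω : Set (EuclideanSpace ℝ (Fin d)))
    (c : Fin N → ℝ → EuclideanSpace ℝ (Fin d) → ℝ) (i : Fin N) : ℝ :=
  ⨍ x in Ω, c i 0 x

/-- `E(t) = ∑ᵢ ∫_Ω cᵢ ln (cᵢ / c̄ᵢ) dx + (ε/2) ∫_Ω |∇Φ|² dx`. -/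
def energy {d N : ℕ} (Ω : Set (EuclideanSpace ℝ (Fin d))) (ε : ℝ)
    (c : Fin N → ℝ → EuclideanSpace ℝ (Fin d) → ℝ) (Φ : ℝ → EuclideanSpace ℝ (Fin d) → ℝ)
    (t : ℝ) : ℝ :=
  (∑ i, ∫ x in Ω, c i t x * Real.log (c i t x / initialMean Ω c i)) +
    ε / 2 * ∫ x in Ω, ‖gradient (Φ t) x‖ ^ 2

/-- `𝓓(t) = ∑ᵢ Dᵢ ∫_Ω cᵢ |∇(ln cᵢ + zᵢ Φ)|² dx`. -/
def dissipation {d N : ℕ} (Ω : Set (EuclideanSpace ℝ (Fin d))) (Dc z : Fin N → ℝ)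
    (c : Fin N → ℝ → EuclideanSpace ℝ (Fin d) → ℝ) (Φ : ℝ → EuclideanSpace ℝ (Fin d) → ℝ)
    (t : ℝ) : ℝ :=
  ∑ i, Dc i * ∫ x in Ω,
    c i t x * ‖gradient (fun y => Real.log (c i t y) + z i * Φ t y) x‖ ^ 2

/-- `𝓓̃(t) = D (∑ᵢ ∫_Ω 4 |∇√cᵢ|² dx + ∫_Ω (2/ε) ρ² + ∑ᵢ zᵢ² cᵢ |∇Φ|² dx)`, `D = minᵢ Dᵢ`
(the infimum of the finite family `Dc`). -/
def reducedDissipation {d N : ℕ} (Ω : Set (EuclideanSpace ℝ (Fin d))) (Dc z : Fin N → ℝ) (ε : ℝ)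
    (c : Fin N → ℝ → EuclideanSpace ℝ (Fin d) → ℝ) (Φ : ℝ → EuclideanSpace ℝ (Fin d) → ℝ)
    (t : ℝ) : ℝ :=
  (⨅ i, Dc i) *
    ((∑ i, ∫ x in Ω, 4 * ‖gradient (fun y => Real.sqrt (c i t y)) x‖ ^ 2) +
      ∫ x in Ω, (2 / ε * chargeDensity z c t x ^ 2 +
        ∑ i, z i ^ 2 * c i t x * ‖gradient (Φ t) x‖ ^ 2))

end NernstPlanckPoisson

end

open MeasureTheory Set
open scoped ContDiff

noncomputable section

open Filter Topology

namespace NernstPlanckPoisson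

/-! The entropy part of the energy changes at the rate `∑ᵢ ∫ ∂ₜcᵢ (ln (cᵢ/c̄ᵢ) + 1)`. By Poisson's
equation the field part is the quadratic form `½ ∫ ρΦ`, whose symmetry gives it the rate `∑ᵢ ∫ ∂ₜcᵢ
zᵢΦ`. Together they test `∂ₜcᵢ` with `ln cᵢ + zᵢΦ` plus a constant. Since the flux is `cᵢ ∇(ln cᵢ +
zᵢΦ)` and is tangential on the boundary, one integration by parts yields `-𝓓`:
`integral_deriv_conc_mul_potential`, `hasDerivAt_energy`.

For the inequality, expand `c|∇(ln c + zΦ)|² = 4|∇√c|² + 2z ∇c·∇Φ + z²c|∇Φ|²`. Summed over species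
without the weights `Dᵢ`, the mixed terms give `2 ∫ ∇ρ·∇Φ = (2/ε) ∫ ρ²`. Each species contributes a
nonnegative integral, so replacing `Dᵢ` by the minimum only lowers the sum.

Two points need care. No time derivative of `Φ` is assumed, so the field energy is differentiated
through the increment formula `field_energy_sub`, in which only `ρ` is differenced. The divergence
theorem is needed only for tangential `C¹` fields, and is proved without surface integrals: cut the
field off near the boundary at scale `1/n`. The cutoff gradient has size `n`, but the normal
component of the field is `O(|φ|)`, so the error is bounded and tends to zero pointwise. -/

variable {d : ℕ} {Ω : Set (EuclideanSpace ℝ (Fin d))}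

/-! ### Local geometry of the domain near a boundary point. -/

namespace IsLocalDefiningFunction

variable {p : EuclideanSpace ℝ (Fin d)} {U : Set (EuclideanSpace ℝ (Fin d))}
  {φ : EuclideanSpace ℝ (Fin d) → ℝ}

lemma contDiffAt (h : IsLocalDefiningFunction Ω p U φ) {x : EuclideanSpace ℝ (Fin d)}
    (hx : x ∈ U) : ContDiffAt ℝ ∞ φ x :=
  h.smooth.contDiffAt (h.isOpen.mem_nhds hx)

lemma differentiableAt (h : IsLocalDefiningFunction Ω p U φ) {x : EuclideanSpace ℝ (Fin d)}
    (hx : x ∈ U) : DifferentiableAt ℝ φ x :=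
  (h.contDiffAt hx).differentiableAt (by simp)

lemma mem_iff (h : IsLocalDefiningFunction Ω p U φ) {x : EuclideanSpace ℝ (Fin d)}
    (hx : x ∈ U) : x ∈ Ω ↔ φ x < 0 := by
  have := Set.ext_iff.1 h.inter_eq x
  simpa [hx] using this

/-- The base point of a local defining function may be moved along the zero set. -/
lemma of_eq_zero (h : IsLocalDefiningFunction Ω p U φ) {y : EuclideanSpace ℝ (Fin d)}
    (hy : y ∈ U) (h0 : φ y = 0) (hg : gradient φ y ≠ 0) : IsLocalDefiningFunction Ω y U φ :=
  ⟨h.isOpen, hy, h.smooth, h0, hg, h.inter_eq⟩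

/-- Near the base point a local defining function grows at a definite rate in the normal
direction. -/
lemma exists_ball_le_fderiv (h : IsLocalDefiningFunction Ω p U φ) :
    ∃ R > 0, Metric.ball p R ⊆ U ∧ ∀ y ∈ Metric.ball p R,
      ‖gradient φ p‖ / 2 ≤ fderiv ℝ φ y (‖gradient φ p‖⁻¹ • gradient φ p) := by
  have hm : 0 < ‖gradient φ p‖ := norm_pos_iff.2 h.gradient_ne_zero
  have hc : ContinuousAt (fun y => fderiv ℝ φ y (‖gradient φ p‖⁻¹ • gradient φ p)) p :=
    (((h.contDiffAt h.mem).fderiv_right (m := 0) (by simp)).continuousAt).clm_apply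
      continuousAt_const
  -- Along the unit gradient the derivative at `p` is the full gradient norm; by continuity half of
  -- it survives on a ball.
  have hp : fderiv ℝ φ p (‖gradient φ p‖⁻¹ • gradient φ p) = ‖gradient φ p‖ := by
    rw [map_smul, ← inner_gradient_left (𝕜 := ℝ), real_inner_self_eq_norm_sq, smul_eq_mul]
    field_simp
  have hev : ∀ᶠ y in 𝓝 p, y ∈ U ∧
      ‖gradient φ p‖ / 2 < fderiv ℝ φ y (‖gradient φ p‖⁻¹ • gradient φ p) := by
    refine (h.isOpen.eventually_mem h.mem).and (hc.eventually_const_lt ?_)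
    simp only [hp]; linarith
  obtain ⟨R, hR, hsub⟩ := Metric.eventually_nhds_iff_ball.1 hev
  exact ⟨R, hR, fun y hy => (hsub y hy).1, fun y hy => (hsub y hy).2.le⟩

/-- Every point `x` of `Ω` close to the boundary is joined inside the closure of `Ω` to a boundary
point at distance `O(|φ x|)`. -/
lemma exists_segment_to_frontier (h : IsLocalDefiningFunction Ω p U φ) {r : ℝ} (hr : 0 < r) :
    ∃ δ > 0, ∃ C : ℝ, 0 ≤ C ∧ ∀ x ∈ Ω ∩ Metric.ball p δ, ∃ y ∈ frontier Ω,
      IsLocalDefiningFunction Ω y U φ ∧ ‖x - y‖ ≤ C * |φ x| ∧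
      segment ℝ x y ⊆ closure Ω ∩ Metric.ball p r := by
  obtain ⟨R₀, hR₀, hsub₀, hgrow₀⟩ := h.exists_ball_le_fderiv
  set m := ‖gradient φ p‖ with hm_def
  set e := m⁻¹ • gradient φ p with he_def
  have hm : 0 < m := norm_pos_iff.2 h.gradient_ne_zero
  have he : ‖e‖ = 1 := by
    rw [he_def, norm_smul, norm_inv, Real.norm_of_nonneg hm.le, ← hm_def, inv_mul_cancel₀ hm.ne']
  set R := min R₀ r
  have hR : 0 < R := lt_min hR₀ hr
  have hsub : Metric.ball p R ⊆ U := (Metric.ball_subset_ball (min_le_left _ _)).trans hsub₀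
  have hgrow : ∀ y ∈ Metric.ball p R, m / 2 ≤ fderiv ℝ φ y e := fun y hy =>
    hgrow₀ y (Metric.ball_subset_ball (min_le_left _ _) hy)
  have hφc : ∀ᶠ x in 𝓝 p, |φ x| < m * R / 4 := by
    refine ((h.differentiableAt h.mem).continuousAt.abs).eventually_lt_const ?_
    show |φ p| < _
    rw [h.zero, abs_zero]; positivity
  obtain ⟨δ₀, hδ₀, hφδ⟩ := Metric.eventually_nhds_iff_ball.1 hφc
  -- Since `φ` grows along `e` at rate at least `m / 2`, it reaches zero from `φ x` within length `2
  -- / m * |φ x|`. The bound `|φ x| < m * R / 4` makes this length less than `R / 2`, so the path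
  -- stays in the ball of radius `R`.
  refine ⟨min δ₀ (R / 2), lt_min hδ₀ (by linarith), 2 / m, by positivity, ?_⟩
  rintro x ⟨hxΩ, hx⟩
  have hx1 : |φ x| < m * R / 4 :=
    hφδ x (Metric.ball_subset_ball (min_le_left _ _) hx)
  have hx2 : ‖x - p‖ < R / 2 := by
    simpa [dist_eq_norm] using Metric.ball_subset_ball (min_le_right _ _) hx
  set s₀ := 2 / m * |φ x| with hs₀_def
  have hs₀ : 0 ≤ s₀ := by positivity
  have hs₀R : s₀ < R / 2 := by
    rw [hs₀_def, div_mul_eq_mul_div, div_lt_iff₀ hm]; linarith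
  have hball : ∀ s ∈ Icc 0 s₀, x + s • e ∈ Metric.ball p R := by
    intro s hs
    rw [mem_ball_iff_norm]
    calc ‖x + s • e - p‖ = ‖(x - p) + s • e‖ := by congr 1; abel
      _ ≤ ‖x - p‖ + ‖s • e‖ := norm_add_le _ _
      _ = ‖x - p‖ + s := by rw [norm_smul, he, mul_one, Real.norm_of_nonneg hs.1]
      _ < R := by linarith [hs.2]
  have hder : ∀ s ∈ Icc 0 s₀, HasDerivAt (fun s : ℝ => φ (x + s • e))
      (fderiv ℝ φ (x + s • e) e) s := by
    intro s hs
    have h1 : HasDerivAt (fun s : ℝ => x + s • e) e s := by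
      simpa using ((hasDerivAt_id s).smul_const e).const_add x
    exact (h.differentiableAt (hsub (hball s hs))).hasFDerivAt.comp_hasDerivAt s h1
  have hcont : ContinuousOn (fun s : ℝ => φ (x + s • e)) (Icc 0 s₀) := fun s hs =>
    (hder s hs).continuousAt.continuousWithinAt
  have hmono : ∀ s ∈ Icc 0 s₀, ∀ t ∈ Icc 0 s₀, s ≤ t →
      m / 2 * (t - s) ≤ φ (x + t • e) - φ (x + s • e) := by
    refine (convex_Icc 0 s₀).mul_sub_le_image_sub_of_le_deriv hcont ?_ ?_
    · exact fun s hs => (hder s (interior_subset hs)).differentiableAt.differentiableWithinAt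
    · intro s hs
      rw [(hder s (interior_subset hs)).deriv]
      exact hgrow _ (hball s (interior_subset hs))
  have hxneg : φ x < 0 := by
    have := hball 0 ⟨le_rfl, hs₀⟩
    rw [zero_smul, add_zero] at this
    exact (h.mem_iff (hsub this)).1 hxΩ
  have hend : 0 ≤ φ (x + s₀ • e) := by
    have := hmono 0 ⟨le_rfl, hs₀⟩ s₀ ⟨hs₀, le_rfl⟩ hs₀
    rw [zero_smul, add_zero, hs₀_def, abs_of_neg hxneg] at this
    rw [hs₀_def, abs_of_neg hxneg]
    have h2 : m / 2 * (2 / m * -φ x - 0) = -φ x := by field_simp; ring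
    linarith
  obtain ⟨s₁, hs₁, hzero⟩ : (0 : ℝ) ∈ (fun s : ℝ => φ (x + s • e)) '' Icc 0 s₀ :=
    intermediate_value_Icc hs₀ hcont ⟨by simpa using hxneg.le, hend⟩
  simp only at hzero
  have hs₁pos : 0 < s₁ := by
    rcases hs₁.1.eq_or_lt with h0 | h0
    · rw [← h0, zero_smul, add_zero] at hzero; exact absurd hzero hxneg.ne
    · exact h0
  -- Strict growth along `e` makes `φ` negative before `s₁`, so only the endpoint leaves `Ω`.
  have hin : (fun s : ℝ => x + s • e) '' Ico 0 s₁ ⊆ Ω := by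
    rintro _ ⟨s, hs, rfl⟩
    have hs' : s ∈ Icc 0 s₀ := ⟨hs.1, hs.2.le.trans hs₁.2⟩
    have := hmono s hs' s₁ hs₁ hs.2.le
    have h3 : 0 < m / 2 * (s₁ - s) := mul_pos (by linarith) (sub_pos.2 hs.2)
    exact (h.mem_iff (hsub (hball s hs'))).2 (by linarith)
  have hcl : (fun s : ℝ => x + s • e) '' Icc 0 s₁ ⊆ closure Ω := by
    rw [← closure_Ico hs₁pos.ne]
    exact (image_closure_subset_closure_image (by fun_prop)).trans (closure_mono hin)
  have hyball := hball s₁ hs₁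
  have hyU := hsub hyball
  have hycl : x + s₁ • e ∈ closure Ω := hcl ⟨s₁, ⟨hs₁pos.le, le_rfl⟩, rfl⟩
  have hyΩ : x + s₁ • e ∉ Ω := fun hy => ((h.mem_iff hyU).1 hy).ne hzero
  have hyg : gradient φ (x + s₁ • e) ≠ 0 := by
    intro h0
    have h1 := hgrow _ hyball
    rw [← inner_gradient_left (𝕜 := ℝ), h0, inner_zero_left] at h1
    linarith
  refine ⟨x + s₁ • e, ⟨hycl, fun hy => hyΩ (interior_subset hy)⟩,
    h.of_eq_zero hyU hzero hyg, ?_, ?_⟩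
  · rw [sub_add_cancel_left, norm_neg, norm_smul, he, mul_one, Real.norm_of_nonneg hs₁.1]
    exact hs₁.2
  · rw [segment_eq_image']
    rintro _ ⟨θ, hθ, rfl⟩
    have hmem : θ * s₁ ∈ Icc 0 s₁ :=
      ⟨mul_nonneg hθ.1 hs₁.1, mul_le_of_le_one_left hs₁.1 hθ.2⟩
    have heq : x + θ • (x + s₁ • e - x) = x + (θ * s₁) • e := by
      rw [add_sub_cancel_left, smul_smul]
    simp only [heq]
    exact ⟨hcl ⟨_, hmem, rfl⟩, Metric.ball_subset_ball (min_le_right _ _)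
      (hball _ ⟨hmem.1, hmem.2.trans hs₁.2⟩)⟩

/-- The closure of `Ω` contains a truncated open cone with apex at each boundary point. -/
lemma uniqueDiffWithinAt (h : IsLocalDefiningFunction Ω p U φ) :
    UniqueDiffWithinAt ℝ (closure Ω) p := by
  set g := gradient φ p with hg_def
  have hm : 0 < ‖g‖ := norm_pos_iff.2 h.gradient_ne_zero
  have hlit := (h.differentiableAt h.mem).hasFDerivAt.isLittleO.def (half_pos hm)
  obtain ⟨R, hR, hball⟩ := Metric.eventually_nhds_iff_ball.1
    (hlit.and (h.isOpen.mem_nhds h.mem))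
  -- The first-order expansion with error `‖g‖ / 2 * ‖y - p‖` forces `φ < 0` on this cone. It is
  -- convex, being a sublevel set of a linear form plus a norm, and `p` lies in its closure via the
  -- points `p - t • g`.
  set V := {y | inner ℝ g (y - p) + ‖g‖ / 2 * ‖y - p‖ < 0} ∩ Metric.ball p R
  have hVopen : IsOpen V := by
    refine IsOpen.inter (isOpen_lt (by fun_prop) continuous_const) Metric.isOpen_ball
  have hVΩ : V ⊆ Ω := by
    rintro y ⟨hy, hyR⟩
    obtain ⟨h1, h2⟩ := hball y hyR
    refine (h.mem_iff h2).2 ?_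
    rw [h.zero, sub_zero, ← inner_gradient_left (𝕜 := ℝ), ← hg_def, Real.norm_eq_abs] at h1
    have := (abs_le.1 h1).2
    have h3 : inner ℝ g (y - p) + ‖g‖ / 2 * ‖y - p‖ < 0 := hy
    linarith
  have hVconv : Convex ℝ V := by
    refine Convex.inter ?_ (convex_ball p R)
    intro y hy w hw a b ha hb hab
    have hy' : inner ℝ g (y - p) + ‖g‖ / 2 * ‖y - p‖ < 0 := hy
    have hw' : inner ℝ g (w - p) + ‖g‖ / 2 * ‖w - p‖ < 0 := hw
    have heq : a • y + b • w - p = a • (y - p) + b • (w - p) := by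
      have : p = (a + b) • p := by rw [hab, one_smul]
      nth_rewrite 1 [this]
      module
    have hn : ‖a • y + b • w - p‖ ≤ a * ‖y - p‖ + b * ‖w - p‖ := by
      rw [heq]
      refine (norm_add_le _ _).trans ?_
      rw [norm_smul, norm_smul, Real.norm_of_nonneg ha, Real.norm_of_nonneg hb]
    have hi : inner ℝ g (a • y + b • w - p) = a * inner ℝ g (y - p) + b * inner ℝ g (w - p) := by
      rw [heq, inner_add_right, inner_smul_right, inner_smul_right]
    show inner ℝ g (a • y + b • w - p) + ‖g‖ / 2 * ‖a • y + b • w - p‖ < 0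
    have hn' := mul_le_mul_of_nonneg_left hn (half_pos hm).le
    rw [hi]
    rcases ha.eq_or_lt with ha0 | ha0
    · have hb1 : b = 1 := by linarith
      subst hb1; subst ha0; nlinarith
    · have := mul_neg_of_pos_of_neg ha0 hy'
      have := mul_nonpos_of_nonneg_of_nonpos hb hw'.le
      nlinarith
  have hmemV : ∀ t : ℝ, t ∈ Ioo 0 (R / ‖g‖) → p - t • g ∈ V := by
    intro t ht
    have h1 : p - t • g - p = -(t • g) := by abel
    refine ⟨?_, ?_⟩
    · show inner ℝ g (p - t • g - p) + ‖g‖ / 2 * ‖p - t • g - p‖ < 0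
      rw [h1, inner_neg_right, inner_smul_right, norm_neg, norm_smul, Real.norm_of_nonneg ht.1.le,
        real_inner_self_eq_norm_sq]
      have := mul_pos ht.1 (pow_pos hm 2)
      nlinarith
    · rw [mem_ball_iff_norm, h1, norm_neg, norm_smul, Real.norm_of_nonneg ht.1.le]
      exact (lt_div_iff₀ hm).1 ht.2
  have hRg : 0 < R / ‖g‖ := div_pos hR hm
  refine (uniqueDiffWithinAt_convex hVconv ?_ ?_).mono (hVΩ.trans subset_closure)
  · rw [hVopen.interior_eq]
    exact ⟨_, hmemV (R / ‖g‖ / 2) ⟨by positivity, by linarith⟩⟩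
  · have himg : (fun t : ℝ => p - t • g) '' Ioo 0 (R / ‖g‖) ⊆ V := by
      rintro _ ⟨t, ht, rfl⟩; exact hmemV t ht
    have := (image_closure_subset_closure_image (f := fun t : ℝ => p - t • g)
      (s := Ioo 0 (R / ‖g‖)) (by fun_prop)).trans (closure_mono himg)
    rw [closure_Ioo hRg.ne] at this
    exact this ⟨0, ⟨le_rfl, hRg.le⟩, by simp⟩

end IsLocalDefiningFunction

/-- Openness settles the interior points and the truncated cone the boundary points. This is what
makes derivatives within the closure unique, hence continuous up to the boundary for `C¹` functions.
-/
lemma IsSmoothBoundedDomain.uniqueDiffOn (hΩ : IsSmoothBoundedDomain Ω) :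
    UniqueDiffOn ℝ (closure Ω) := by
  intro x hx
  by_cases hxΩ : x ∈ Ω
  · exact (hΩ.isOpen.uniqueDiffWithinAt hxΩ).mono subset_closure
  · obtain ⟨U, φ, h⟩ := hΩ.smooth_boundary x ⟨hx, fun h => hxΩ (interior_subset h)⟩
    exact h.uniqueDiffWithinAt

lemma IsSmoothBoundedDomain.isCompact_closure (hΩ : IsSmoothBoundedDomain Ω) :
    IsCompact (closure Ω) :=
  hΩ.isBounded.isCompact_closure

/-! ### Tangential fields near the boundary. -/

/-- The vector field `F` is tangential on the boundary of `Ω`. -/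
def ZeroFlux (Ω : Set (EuclideanSpace ℝ (Fin d)))
    (F : EuclideanSpace ℝ (Fin d) → EuclideanSpace ℝ (Fin d)) : Prop :=
  ∀ p ∈ frontier Ω, ∀ ν, IsOutwardUnitNormal Ω p ν → inner ℝ (F p) ν = 0

/-- A tangential `C¹` field has normal component `O(|φ|)` near the boundary. -/
lemma IsLocalDefiningFunction.exists_abs_fderiv_le (hΩ : IsSmoothBoundedDomain Ω)
    {p : EuclideanSpace ℝ (Fin d)} (hp : p ∈ frontier Ω) {U : Set (EuclideanSpace ℝ (Fin d))}
    {φ : EuclideanSpace ℝ (Fin d) → ℝ} (h : IsLocalDefiningFunction Ω p U φ)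
    {F : EuclideanSpace ℝ (Fin d) → EuclideanSpace ℝ (Fin d)}
    (hF : ContDiffOn ℝ 1 F (closure Ω)) (hflux : ZeroFlux Ω F) :
    ∃ δ > 0, ∃ C : ℝ, ∀ x ∈ Ω ∩ Metric.ball p δ, |fderiv ℝ φ x (F x)| ≤ C * |φ x| := by
  set f : EuclideanSpace ℝ (Fin d) → ℝ := fun x => fderiv ℝ φ x (F x) with hf_def
  have hUD : UniqueDiffOn ℝ (closure Ω ∩ U) := hΩ.uniqueDiffOn.inter h.isOpen
  have hf : ContDiffOn ℝ 1 f (closure Ω ∩ U) := by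
    refine ContDiffOn.clm_apply ?_ (hF.mono inter_subset_left)
    exact (h.smooth.fderiv_of_isOpen h.isOpen (m := 1) (by norm_cast)).mono inter_subset_right
  have hp' : p ∈ closure Ω ∩ U := ⟨frontier_subset_closure hp, h.mem⟩
  have hcont := (hf.continuousOn_fderivWithin hUD le_rfl p hp').norm
  set K := ‖fderivWithin ℝ f (closure Ω ∩ U) p‖ + 1 with hK
  have hev : ∀ᶠ x in 𝓝[closure Ω ∩ U] p, ‖fderivWithin ℝ f (closure Ω ∩ U) x‖ < K :=
    hcont.tendsto.eventually_lt_const (by linarith)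
  rw [eventually_nhdsWithin_iff] at hev
  obtain ⟨r, hr, hbound⟩ := Metric.eventually_nhds_iff_ball.1
    (hev.and (h.isOpen.mem_nhds h.mem))
  obtain ⟨δ, hδ, C, hC, hseg⟩ := h.exists_segment_to_frontier hr
  refine ⟨δ, hδ, K * C, fun x hx => ?_⟩
  obtain ⟨y, hy, hydef, hxy, hsub⟩ := hseg x hx
  have hsub' : segment ℝ x y ⊆ closure Ω ∩ U := fun w hw =>
    ⟨(hsub hw).1, (hbound w (hsub hw).2).2⟩
  -- `φ` is also a defining function at the foot point `y`, so its normalized gradient there is an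
  -- admissible outward normal.
  have hfy : f y = 0 := by
    have hn : 0 < ‖gradient φ y‖ := norm_pos_iff.2 hydef.gradient_ne_zero
    have h0 := hflux y hy _ ⟨U, φ, hydef, rfl⟩
    rw [inner_smul_right, real_inner_comm, inner_gradient_left] at h0
    exact (mul_eq_zero.1 h0).resolve_left (inv_pos.2 hn).ne'
  -- The closure need not be convex; the mean value inequality is applied on the segment to the foot
  -- point alone.
  have hmv := (convex_segment x y).norm_image_sub_le_of_norm_hasFDerivWithin_le
    (f := f) (f' := fderivWithin ℝ f (closure Ω ∩ U)) (C := K)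
    (fun w hw => ((hf.differentiableOn (by simp) w (hsub' hw)).hasFDerivWithinAt).mono hsub')
    (fun w hw => ((hbound w (hsub hw).2).1 (hsub' hw)).le)
    (right_mem_segment ℝ x y) (left_mem_segment ℝ x y)
  rw [hfy, sub_zero, Real.norm_eq_abs] at hmv
  calc |f x| ≤ K * ‖x - y‖ := hmv
    _ ≤ K * (C * |φ x|) := mul_le_mul_of_nonneg_left hxy (by positivity)
    _ = K * C * |φ x| := by ring

/-! ### The divergence theorem for tangential fields. -/

lemma contDiff_of_forall_mem_tsupport {G : Type*} [NormedAddCommGroup G] [NormedSpace ℝ G]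
    {f : EuclideanSpace ℝ (Fin d) → G}
    (hf : ∀ x ∈ tsupport f, ContDiffAt ℝ 1 f x) : ContDiff ℝ 1 f := by
  refine contDiff_iff_contDiffAt.2 fun x => ?_
  by_cases hx : x ∈ tsupport f
  · exact hf x hx
  · exact contDiffAt_const.congr_of_eventuallyEq (notMem_tsupport_iff_eventuallyEq.1 hx)

lemma divergence_congr {F G : EuclideanSpace ℝ (Fin d) → EuclideanSpace ℝ (Fin d)}
    {x : EuclideanSpace ℝ (Fin d)} (h : F =ᶠ[𝓝 x] G) : divergence F x = divergence G x := by
  simp only [divergence, h.fderiv_eq]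

/-- Leibniz rule for the divergence. -/
lemma divergence_smul {u : EuclideanSpace ℝ (Fin d) → ℝ}
    {F : EuclideanSpace ℝ (Fin d) → EuclideanSpace ℝ (Fin d)} {x : EuclideanSpace ℝ (Fin d)}
    (hu : DifferentiableAt ℝ u x) (hF : DifferentiableAt ℝ F x) :
    divergence (fun y => u y • F y) x = u x * divergence F x + fderiv ℝ u x (F x) := by
  have hsum : F x = ∑ j, F x j • EuclideanSpace.single j (1 : ℝ) := by
    have := (EuclideanSpace.basisFun (Fin d) ℝ).sum_repr (F x)
    simpa using this.symm
  conv_rhs => rw [hsum]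
  simp only [divergence, fderiv_fun_smul hu hF, map_sum, map_smul, Finset.mul_sum,
    ← Finset.sum_add_distrib]
  refine Finset.sum_congr rfl fun j _ => ?_
  simp [mul_comm]

/-- Each partial derivative integrates to zero, by integration by parts on the whole space against
the constant `1`. -/
lemma integral_divergence_eq_zero_of_hasCompactSupport
    {F : EuclideanSpace ℝ (Fin d) → EuclideanSpace ℝ (Fin d)} (hF : ContDiff ℝ 1 F)
    (hc : HasCompactSupport F) : ∫ x, divergence F x = 0 := by
  have hcd : ∀ j, Continuous fun x => (fderiv ℝ F x (EuclideanSpace.single j (1 : ℝ))) j := by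
    intro j
    have := hF.continuous_fderiv (by simp)
    fun_prop
  have hint : ∀ j, Integrable fun x => (fderiv ℝ F x (EuclideanSpace.single j (1 : ℝ))) j := by
    intro j
    refine (hcd j).integrable_of_hasCompactSupport ?_
    refine (hc.fderiv (𝕜 := ℝ)).mono' (subset_closure.trans' ?_)
    intro x hx h0
    exact hx (by simp [h0])
  unfold divergence
  rw [integral_finsetSum _ fun j _ => hint j]
  refine Finset.sum_eq_zero fun j _ => ?_
  set π : EuclideanSpace ℝ (Fin d) →L[ℝ] ℝ := EuclideanSpace.proj j with hπ
  have hder : ∀ x, HasFDerivAt (fun y => F y j) (π.comp (fderiv ℝ F x)) x := fun x =>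
    π.hasFDerivAt.comp x (hF.differentiable (by simp) x).hasFDerivAt
  have := integral_bilinear_hasFDerivAt_right_eq_neg_left_of_integrable
    (μ := (volume : Measure (EuclideanSpace ℝ (Fin d))))
    (f := fun _ => (1 : ℝ)) (f' := fun _ => 0) (g := fun y => F y j)
    (g' := fun x => π.comp (fderiv ℝ F x))
    (v := EuclideanSpace.single j (1 : ℝ)) (B := ContinuousLinearMap.mul ℝ ℝ)
    (by simp) (by simpa [hπ] using hint j) ?_ (fun x _ => hasFDerivAt_const _ _)
    (fun x _ => hder x)
  · simpa [hπ] using this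
  · have hcj : Continuous fun y => F y j := π.continuous.comp hF.continuous
    have : Integrable fun y => F y j := hcj.integrable_of_hasCompactSupport
      (hc.comp_left (g := fun v : EuclideanSpace ℝ (Fin d) => v j) rfl)
    simpa using this

/-- The integrand of the weak divergence of `F`, tested with `ψ`. -/
def weakDivergenceIntegrand (F : EuclideanSpace ℝ (Fin d) → EuclideanSpace ℝ (Fin d))
    (ψ : EuclideanSpace ℝ (Fin d) → ℝ) (x : EuclideanSpace ℝ (Fin d)) : ℝ :=
  ψ x * divergence F x + fderiv ℝ ψ x (F x)

/-- The product `ζ F` is a compactly supported `C¹` field on the whole space, whatever `F` is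
outside `Ω`, and on `Ω` the integrand is its divergence. -/
lemma integral_weakDivergenceIntegrand_of_tsupport_subset (hΩ : IsOpen Ω)
    {F : EuclideanSpace ℝ (Fin d) → EuclideanSpace ℝ (Fin d)} (hF : ContDiffOn ℝ 1 F Ω)
    {ζ : EuclideanSpace ℝ (Fin d) → ℝ} (hζ : ContDiff ℝ 1 ζ) (hc : HasCompactSupport ζ)
    (hsub : tsupport ζ ⊆ Ω) : ∫ x in Ω, weakDivergenceIntegrand F ζ x = 0 := by
  have hprod : ContDiff ℝ 1 fun y => ζ y • F y := by
    refine contDiff_of_forall_mem_tsupport fun x hx => ?_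
    have hx' : x ∈ Ω := hsub (tsupport_smul_subset_left ζ F hx)
    exact hζ.contDiffAt.smul (hF.contDiffAt (hΩ.mem_nhds hx'))
  have key := integral_divergence_eq_zero_of_hasCompactSupport hprod (hc.smul_right (f' := F))
  have heq : ∀ x ∈ Ω, divergence (fun y => ζ y • F y) x = weakDivergenceIntegrand F ζ x :=
    fun x hx => divergence_smul (hζ.differentiable (by simp) x)
      ((hF.contDiffAt (hΩ.mem_nhds hx)).differentiableAt (by simp))
  rw [← key, ← setIntegral_congr_fun hΩ.measurableSet heq]
  refine setIntegral_eq_integral_of_forall_compl_eq_zero fun x hx => ?_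
  have h0 : (fun y => ζ y • F y) =ᶠ[𝓝 x] fun _ => 0 := by
    have : ζ =ᶠ[𝓝 x] 0 := notMem_tsupport_iff_eventuallyEq.1 fun h => hx (hsub h)
    filter_upwards [this] with y hy
    simp [hy]
  rw [divergence_congr h0]
  simp [divergence]

lemma IsSmoothBoundedDomain.integrableOn_of_continuousOn {G : Type*} [NormedAddCommGroup G]
    (hΩ : IsSmoothBoundedDomain Ω) {f : EuclideanSpace ℝ (Fin d) → G}
    (hf : ContinuousOn f (closure Ω)) : IntegrableOn f Ω :=
  (hf.integrableOn_compact hΩ.isCompact_closure).mono_set subset_closure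

/-- A `C¹` field on the closure has a divergence extending continuously to the closure. -/
lemma IsSmoothBoundedDomain.exists_continuousOn_eq_divergence (hΩ : IsSmoothBoundedDomain Ω)
    {F : EuclideanSpace ℝ (Fin d) → EuclideanSpace ℝ (Fin d)}
    (hF : ContDiffOn ℝ 1 F (closure Ω)) :
    ∃ g, ContinuousOn g (closure Ω) ∧ ∀ x ∈ Ω, divergence F x = g x := by
  refine ⟨fun x => ∑ j, (fderivWithin ℝ F (closure Ω) x (EuclideanSpace.single j 1)) j, ?_, ?_⟩
  · have := hF.continuousOn_fderivWithin hΩ.uniqueDiffOn le_rfl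
    refine continuousOn_finsetSum _ fun j _ => ?_
    exact (EuclideanSpace.proj (𝕜 := ℝ) j).continuous.comp_continuousOn
      (this.clm_apply continuousOn_const)
  · intro x hx
    have : closure Ω ∈ 𝓝 x := mem_of_superset (hΩ.isOpen.mem_nhds hx) subset_closure
    simp only [divergence, fderivWithin_of_mem_nhds this]

lemma IsSmoothBoundedDomain.integrableOn_mul_divergence (hΩ : IsSmoothBoundedDomain Ω)
    {F : EuclideanSpace ℝ (Fin d) → EuclideanSpace ℝ (Fin d)}
    (hF : ContDiffOn ℝ 1 F (closure Ω)) {ψ : EuclideanSpace ℝ (Fin d) → ℝ}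
    (hψ : ContinuousOn ψ (closure Ω)) : IntegrableOn (fun x => ψ x * divergence F x) Ω := by
  obtain ⟨g, hg, heq⟩ := hΩ.exists_continuousOn_eq_divergence hF
  exact (hΩ.integrableOn_of_continuousOn (hψ.mul hg)).congr_fun
    (fun x hx => by simp [heq x hx]) hΩ.isOpen.measurableSet

lemma IsSmoothBoundedDomain.integrableOn_fderiv_apply (hΩ : IsSmoothBoundedDomain Ω)
    {F : EuclideanSpace ℝ (Fin d) → EuclideanSpace ℝ (Fin d)}
    (hF : ContinuousOn F (closure Ω)) {ψ : EuclideanSpace ℝ (Fin d) → ℝ}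
    (hψ : ContDiff ℝ 1 ψ) : IntegrableOn (fun x => fderiv ℝ ψ x (F x)) Ω :=
  hΩ.integrableOn_of_continuousOn
    ((hψ.continuous_fderiv (by simp)).continuousOn.clm_apply hF)

lemma IsSmoothBoundedDomain.integrableOn_weakDivergenceIntegrand (hΩ : IsSmoothBoundedDomain Ω)
    {F : EuclideanSpace ℝ (Fin d) → EuclideanSpace ℝ (Fin d)}
    (hF : ContDiffOn ℝ 1 F (closure Ω)) {ψ : EuclideanSpace ℝ (Fin d) → ℝ}
    (hψ : ContDiff ℝ 1 ψ) : IntegrableOn (weakDivergenceIntegrand F ψ) Ω :=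
  (hΩ.integrableOn_mul_divergence hF hψ.continuous.continuousOn).add
    (hΩ.integrableOn_fderiv_apply hF.continuousOn hψ)

lemma deriv_smoothTransition_of_one_lt {s : ℝ} (hs : 1 < s) :
    deriv Real.smoothTransition s = 0 := by
  have : Real.smoothTransition =ᶠ[𝓝 s] fun _ => 1 := by
    filter_upwards [Ioi_mem_nhds hs] with t ht
    exact Real.smoothTransition.one_of_one_le (le_of_lt ht)
  rw [this.deriv_eq, deriv_const]

/-- The derivative of the smooth step is concentrated where the step argument is bounded. -/
lemma exists_abs_deriv_smoothTransition_mul_le :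
    ∃ M : ℝ, 0 ≤ M ∧ ∀ s : ℝ, |deriv Real.smoothTransition s * (s + 1)| ≤ M := by
  have hc : Continuous fun s : ℝ => |deriv Real.smoothTransition s * (s + 1)| := by
    have : Continuous (deriv Real.smoothTransition) :=
      (Real.smoothTransition.contDiff (n := 1)).continuous_deriv (by simp)
    fun_prop
  obtain ⟨M, hM⟩ := isCompact_Icc.bddAbove_image (hc.continuousOn (s := Icc (0 : ℝ) 1))
  refine ⟨max M 0, le_max_right _ _, fun s => ?_⟩
  by_cases hs : s ∈ Icc (0 : ℝ) 1
  · exact (hM ⟨s, hs, rfl⟩).trans (le_max_left _ _)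
  · have : deriv Real.smoothTransition s = 0 := by
      rw [mem_Icc, not_and_or, not_le, not_le] at hs
      rcases hs with hs | hs
      · have : Real.smoothTransition =ᶠ[𝓝 s] fun _ => 0 := by
          filter_upwards [Iio_mem_nhds hs] with t ht
          exact Real.smoothTransition.zero_of_nonpos (le_of_lt ht)
        rw [this.deriv_eq, deriv_const]
      · exact deriv_smoothTransition_of_one_lt hs
    rw [this, zero_mul, abs_zero]
    exact le_max_right _ _

/-- Divergence theorem for a tangential field localized near a boundary point. -/
lemma IsLocalDefiningFunction.exists_integral_weakDivergenceIntegrand_eq_zero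
    (hΩ : IsSmoothBoundedDomain Ω)
    {p : EuclideanSpace ℝ (Fin d)} (hp : p ∈ frontier Ω) {U : Set (EuclideanSpace ℝ (Fin d))}
    {φ : EuclideanSpace ℝ (Fin d) → ℝ} (h : IsLocalDefiningFunction Ω p U φ)
    {F : EuclideanSpace ℝ (Fin d) → EuclideanSpace ℝ (Fin d)}
    (hF : ContDiffOn ℝ 1 F (closure Ω)) (hflux : ZeroFlux Ω F) :
    ∃ r > 0, ∀ ψ : EuclideanSpace ℝ (Fin d) → ℝ, ContDiff ℝ 1 ψ → HasCompactSupport ψ →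
      tsupport ψ ⊆ Metric.ball p r → ∫ x in Ω, weakDivergenceIntegrand F ψ x = 0 := by
  obtain ⟨δ, hδ, C, hC⟩ := h.exists_abs_fderiv_le hΩ hp hF hflux
  obtain ⟨R, hR, hRU⟩ := Metric.isOpen_iff.1 h.isOpen p h.mem
  obtain ⟨M, hM0, hM⟩ := exists_abs_deriv_smoothTransition_mul_le
  refine ⟨min δ R, lt_min hδ hR, fun ψ hψ hψc hψs => ?_⟩
  have hψU : tsupport ψ ⊆ U :=
    hψs.trans ((Metric.ball_subset_ball (min_le_right _ _)).trans hRU)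
  have hψδ : tsupport ψ ⊆ Metric.ball p δ :=
    hψs.trans (Metric.ball_subset_ball (min_le_left _ _))
  -- The cutoff vanishes where `-n φ ≤ 1` and equals one where `-n φ ≥ 2`. The shift by `1` keeps
  -- the support of `ψ * χ n` inside `Ω`, away from the zero set of `φ`.
  set χ : ℕ → EuclideanSpace ℝ (Fin d) → ℝ :=
    fun n x => Real.smoothTransition (-(n : ℝ) * φ x - 1) with hχ
  have hχd : ∀ n, ∀ x ∈ U, HasFDerivAt (χ n)
      ((deriv Real.smoothTransition (-(n : ℝ) * φ x - 1) * -(n : ℝ)) • fderiv ℝ φ x) x := by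
    intro n x hx
    have h1 : HasFDerivAt (fun x => -(n : ℝ) * φ x - 1) (-(n : ℝ) • fderiv ℝ φ x) x :=
      ((h.differentiableAt hx).hasFDerivAt.const_mul _).sub_const 1
    have h2 : HasDerivAt Real.smoothTransition
        (deriv Real.smoothTransition (-(n : ℝ) * φ x - 1)) (-(n : ℝ) * φ x - 1) :=
      ((Real.smoothTransition.contDiff (n := 1)).differentiable (by simp) _).hasDerivAt
    have := h2.comp_hasFDerivAt x h1
    rwa [smul_smul] at this
  have hζ : ∀ n, ContDiff ℝ 1 fun x => ψ x * χ n x := by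
    intro n
    refine contDiff_of_forall_mem_tsupport fun x hx => ?_
    have hxU : x ∈ U := hψU (tsupport_mul_subset_left hx)
    refine hψ.contDiffAt.mul ?_
    refine (Real.smoothTransition.contDiffAt (n := 1)).comp x ?_
    exact (contDiffAt_const.mul ((h.contDiffAt hxU).of_le (by norm_cast))).sub contDiffAt_const
  have hζs : ∀ n, tsupport (fun x => ψ x * χ n x) ⊆ Ω := by
    intro n
    have hcl : IsClosed (tsupport ψ ∩ {x | -(n : ℝ) * φ x - 1 ∈ Ici (0 : ℝ)}) := by
      refine ContinuousOn.preimage_isClosed_of_isClosed ?_ (isClosed_tsupport ψ) isClosed_Ici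
      intro x hx
      have := (h.differentiableAt (hψU hx)).continuousAt
      exact ((continuousAt_const.mul this).sub continuousAt_const).continuousWithinAt
    have hsupp : Function.support (fun x => ψ x * χ n x) ⊆
        tsupport ψ ∩ {x | -(n : ℝ) * φ x - 1 ∈ Ici (0 : ℝ)} := by
      intro x hx
      have h1 : ψ x ≠ 0 := left_ne_zero_of_mul hx
      have h2 : χ n x ≠ 0 := right_ne_zero_of_mul hx
      refine ⟨subset_tsupport ψ h1, ?_⟩
      by_contra h3
      exact h2 (Real.smoothTransition.zero_of_nonpos (not_le.1 h3).le)
    refine (closure_minimal hsupp hcl).trans ?_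
    rintro x ⟨hx, hx1⟩
    refine (h.mem_iff (hψU hx)).2 ?_
    by_contra h3
    have h4 : 0 ≤ (n : ℝ) * φ x := mul_nonneg n.cast_nonneg (not_lt.1 h3)
    have h5 : (0 : ℝ) ≤ -(n : ℝ) * φ x - 1 := hx1
    linarith
  have hzero : ∀ n, ∫ x in Ω, weakDivergenceIntegrand F (fun x => ψ x * χ n x) x = 0 :=
    fun n => integral_weakDivergenceIntegrand_of_tsupport_subset hΩ.isOpen
      (hF.mono subset_closure) (hζ n) hψc.mul_right (hζs n)
  have hout : ∀ n, ∀ x ∉ tsupport ψ, weakDivergenceIntegrand F (fun x => ψ x * χ n x) x = 0 ∧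
      weakDivergenceIntegrand F ψ x = 0 := by
    intro n x hx
    have h0 : ψ =ᶠ[𝓝 x] fun _ => 0 := notMem_tsupport_iff_eventuallyEq.1 hx
    have h1 : (fun x => ψ x * χ n x) =ᶠ[𝓝 x] fun _ => 0 := by
      filter_upwards [h0] with y hy
      rw [hy, zero_mul]
    simp [weakDivergenceIntegrand, h0.fderiv_eq, h1.fderiv_eq, h0.eq_of_nhds]
  have hin : ∀ n, ∀ x ∈ tsupport ψ, weakDivergenceIntegrand F (fun x => ψ x * χ n x) x =
      χ n x * weakDivergenceIntegrand F ψ x +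
        ψ x * (deriv Real.smoothTransition (-(n : ℝ) * φ x - 1) * (-(n : ℝ) *
          fderiv ℝ φ x (F x))) := by
    intro n x hx
    have h1 : HasFDerivAt (fun y => ψ y * χ n y) _ x :=
      (hψ.differentiable (by simp) x).hasFDerivAt.mul (hχd n x (hψU hx))
    simp only [weakDivergenceIntegrand, h1.fderiv]
    simp
    ring
  -- Dominated convergence: at a fixed point of `Ω` the cutoff is eventually locally one, so its
  -- derivative term disappears.
  have hlim : Tendsto (fun n => ∫ x in Ω, weakDivergenceIntegrand F (fun x => ψ x * χ n x) x)
      atTop (𝓝 (∫ x in Ω, weakDivergenceIntegrand F ψ x)) := by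
    refine tendsto_integral_of_dominated_convergence
      (fun x => |weakDivergenceIntegrand F ψ x| + |ψ x| * (M * |C|)) ?_ ?_ ?_ ?_
    · exact fun n => (hΩ.integrableOn_weakDivergenceIntegrand hF (hζ n)).aestronglyMeasurable
    · refine (hΩ.integrableOn_weakDivergenceIntegrand hF hψ).abs.add ?_
      exact hΩ.integrableOn_of_continuousOn
        ((hψ.continuous.abs.mul continuous_const).continuousOn)
    · intro n
      refine (ae_restrict_mem hΩ.isOpen.measurableSet).mono fun x hxΩ => ?_
      by_cases hx : x ∈ tsupport ψ
      · rw [hin n x hx, Real.norm_eq_abs]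
        refine (abs_add_le _ _).trans (add_le_add ?_ ?_)
        · rw [abs_mul, abs_of_nonneg (Real.smoothTransition.nonneg _)]
          exact mul_le_of_le_one_left (abs_nonneg _) (Real.smoothTransition.le_one _)
        · rw [abs_mul]
          refine mul_le_mul_of_nonneg_left ?_ (abs_nonneg _)
          -- Tangentiality gives `|∇φ·F| ≤ C|φ|`. With `s = -n φ - 1` one has `s + 1 = -n φ`, so `M`
          -- absorbs the factor `n` uniformly.
          have h1 := hC x ⟨hxΩ, hψδ hx⟩
          have h2 := hM (-(n : ℝ) * φ x - 1)
          rw [sub_add_cancel, abs_mul] at h2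
          rw [abs_mul, abs_mul]
          rw [abs_mul] at h2
          calc _ ≤ |deriv Real.smoothTransition (-(n : ℝ) * φ x - 1)| *
                (|-(n : ℝ)| * (|C| * |φ x|)) := by
                gcongr
                exact h1.trans (mul_le_mul_of_nonneg_right (le_abs_self C) (abs_nonneg _))
            _ = |deriv Real.smoothTransition (-(n : ℝ) * φ x - 1)| *
                (|-(n : ℝ)| * |φ x|) * |C| := by ring
            _ ≤ M * |C| := mul_le_mul_of_nonneg_right h2 (abs_nonneg _)
      · rw [(hout n x hx).1, norm_zero]
        positivity
    · refine (ae_restrict_mem hΩ.isOpen.measurableSet).mono fun x hxΩ => ?_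
      by_cases hx : x ∈ tsupport ψ
      · have hneg : φ x < 0 := (h.mem_iff (hψU hx)).1 hxΩ
        refine tendsto_const_nhds.congr' ?_
        have hev : ∀ᶠ n : ℕ in atTop, 2 / -φ x < n :=
          (tendsto_natCast_atTop_atTop (R := ℝ)).eventually_gt_atTop _
        filter_upwards [hev] with n hn
        have h1 : 1 < -(n : ℝ) * φ x - 1 := by
          rw [div_lt_iff₀ (by linarith)] at hn
          linarith
        have h2 : χ n x = 1 := Real.smoothTransition.one_of_one_le h1.le
        rw [hin n x hx, deriv_smoothTransition_of_one_lt h1, h2]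
        simp
      · simp only [(hout 0 x hx).2, fun n => (hout n x hx).1]
        exact tendsto_const_nhds
  simp only [hzero] at hlim
  exact (tendsto_nhds_unique hlim tendsto_const_nhds)

lemma weakDivergenceIntegrand_add
    {F : EuclideanSpace ℝ (Fin d) → EuclideanSpace ℝ (Fin d)}
    {ψ η : EuclideanSpace ℝ (Fin d) → ℝ} (hψ : ContDiff ℝ 1 ψ) (hη : ContDiff ℝ 1 η)
    (x : EuclideanSpace ℝ (Fin d)) :
    weakDivergenceIntegrand F (fun y => ψ y + η y) x =
      weakDivergenceIntegrand F ψ x + weakDivergenceIntegrand F η x := by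
  unfold weakDivergenceIntegrand
  rw [fderiv_fun_add (hψ.differentiable (by simp) x) (hη.differentiable (by simp) x)]
  simp
  ring

/-- **Divergence theorem** for tangential vector fields on a smooth bounded domain. -/
theorem IsSmoothBoundedDomain.integral_divergence_eq_zero (hΩ : IsSmoothBoundedDomain Ω)
    {F : EuclideanSpace ℝ (Fin d) → EuclideanSpace ℝ (Fin d)}
    (hF : ContDiffOn ℝ 1 F (closure Ω)) (hflux : ZeroFlux Ω F) :
    ∫ x in Ω, divergence F x = 0 := by
  obtain ⟨θ, hθ, hθ1, hθ0⟩ : ∃ θ : EuclideanSpace ℝ (Fin d) → ℝ, ContDiff ℝ 1 θ ∧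
      (∀ x ∈ closure Ω, θ x = 1) ∧ ∀ ψ : EuclideanSpace ℝ (Fin d) → ℝ, ContDiff ℝ 1 ψ →
        ∫ x in Ω, weakDivergenceIntegrand F (fun y => ψ y * θ y) x = 0 := by
    -- Compactness induction in place of a partition of unity. The property quantifies over all `ψ`
    -- so that it survives multiplication of test functions.
    refine hΩ.isCompact_closure.induction_on (p := fun s => ∃ θ : EuclideanSpace ℝ (Fin d) → ℝ,
      ContDiff ℝ 1 θ ∧ (∀ x ∈ s, θ x = 1) ∧ ∀ ψ : EuclideanSpace ℝ (Fin d) → ℝ, ContDiff ℝ 1 ψ →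
        ∫ x in Ω, weakDivergenceIntegrand F (fun y => ψ y * θ y) x = 0) ?_ ?_ ?_ ?_
    · exact ⟨fun _ => 0, contDiff_const, by simp, by simp [weakDivergenceIntegrand]⟩
    · rintro s t hst ⟨θ, h1, h2, h3⟩
      exact ⟨θ, h1, fun x hx => h2 x (hst hx), h3⟩
    · rintro s t ⟨θ, h1, h2, h3⟩ ⟨η, k1, k2, k3⟩
      -- The witness is `1 - (1 - θ)(1 - η)`, equal to one as soon as either factor is; its second
      -- summand is handled by testing `η` with `ψ (1 - θ)`.
      refine ⟨fun x => θ x + (1 - θ x) * η x, h1.add ((contDiff_const.sub h1).mul k1), ?_, ?_⟩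
      · rintro x (hx | hx)
        · simp [h2 x hx]
        · simp [k2 x hx]
      · intro ψ hψ
        have hsplit : (fun y => ψ y * (θ y + (1 - θ y) * η y)) =
            fun y => ψ y * θ y + (ψ y * (1 - θ y)) * η y := by
          funext y; ring
        have hψ' : ContDiff ℝ 1 fun y => ψ y * (1 - θ y) := hψ.mul (contDiff_const.sub h1)
        rw [hsplit]
        simp only [weakDivergenceIntegrand_add (hψ.mul h1) (hψ'.mul k1)]
        rw [integral_add (hΩ.integrableOn_weakDivergenceIntegrand hF (hψ.mul h1))
          (hΩ.integrableOn_weakDivergenceIntegrand hF (hψ'.mul k1)), h3 ψ hψ, k3 _ hψ', add_zero]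
    · intro x hx
      obtain ⟨r, hr, hvan⟩ : ∃ r > 0, ∀ ψ : EuclideanSpace ℝ (Fin d) → ℝ, ContDiff ℝ 1 ψ →
          HasCompactSupport ψ → tsupport ψ ⊆ Metric.ball x r →
            ∫ y in Ω, weakDivergenceIntegrand F ψ y = 0 := by
        by_cases hxΩ : x ∈ Ω
        · obtain ⟨r, hr, hsub⟩ := Metric.isOpen_iff.1 hΩ.isOpen x hxΩ
          exact ⟨r, hr, fun ψ h1 h2 h3 => integral_weakDivergenceIntegrand_of_tsupport_subset
            hΩ.isOpen (hF.mono subset_closure) h1 h2 (h3.trans hsub)⟩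
        · have hxf : x ∈ frontier Ω := ⟨hx, fun h => hxΩ (interior_subset h)⟩
          obtain ⟨U, φ, h⟩ := hΩ.smooth_boundary x hxf
          exact h.exists_integral_weakDivergenceIntegrand_eq_zero hΩ hxf hF hflux
      let b : ContDiffBump x := ⟨r / 4, r / 2, by linarith, by linarith⟩
      refine ⟨Metric.ball x (r / 4), mem_nhdsWithin_of_mem_nhds (Metric.ball_mem_nhds _
        (by linarith)), b, b.contDiff, ?_, ?_⟩
      · exact fun y hy => b.one_of_mem_closedBall (Metric.ball_subset_closedBall hy)
      · intro ψ hψ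
        refine hvan _ (hψ.mul b.contDiff) b.hasCompactSupport.mul_left ?_
        refine (tsupport_mul_subset_right).trans ?_
        rw [b.tsupport_eq]
        exact Metric.closedBall_subset_ball (by show r / 2 < r; linarith)
  -- With `ψ = 1` the test function is locally constant on `Ω`, leaving only the divergence.
  rw [← hθ0 (fun _ => 1) contDiff_const]
  refine setIntegral_congr_fun hΩ.isOpen.measurableSet fun x hx => ?_
  have h1 : (fun y => 1 * θ y) =ᶠ[𝓝 x] fun _ => 1 := by
    filter_upwards [hΩ.isOpen.mem_nhds hx] with y hy
    rw [one_mul, hθ1 y (subset_closure hy)]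
  simp only [weakDivergenceIntegrand, h1.fderiv_eq, h1.eq_of_nhds]
  simp

/-! ### Gradients up to the boundary and Green's formula -/

/-- `gradient` is not controlled on the boundary, whereas `gradientWithin` is continuous up to it
for `C¹` functions. Agreement on `Ω` lets one replace the other under the integrals. -/
lemma gradientWithin_closure_eq (hΩ : IsOpen Ω) (f : EuclideanSpace ℝ (Fin d) → ℝ)
    {x : EuclideanSpace ℝ (Fin d)} (hx : x ∈ Ω) :
    gradientWithin f (closure Ω) x = gradient f x := by
  have : closure Ω ∈ 𝓝 x := mem_of_superset (hΩ.mem_nhds hx) subset_closure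
  simp only [gradientWithin, gradient, fderivWithin_of_mem_nhds this]

lemma IsSmoothBoundedDomain.contDiffOn_gradientWithin (hΩ : IsSmoothBoundedDomain Ω)
    {f : EuclideanSpace ℝ (Fin d) → ℝ} (hf : ContDiffOn ℝ 2 f (closure Ω)) :
    ContDiffOn ℝ 1 (gradientWithin f (closure Ω)) (closure Ω) :=
  (InnerProductSpace.toDual ℝ (EuclideanSpace ℝ (Fin d))).symm.contDiff.comp_contDiffOn
    (hf.fderivWithin hΩ.uniqueDiffOn (by norm_num))

lemma IsSmoothBoundedDomain.continuousOn_gradientWithin (hΩ : IsSmoothBoundedDomain Ω)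
    {f : EuclideanSpace ℝ (Fin d) → ℝ} (hf : ContDiffOn ℝ 1 f (closure Ω)) :
    ContinuousOn (gradientWithin f (closure Ω)) (closure Ω) :=
  (InnerProductSpace.toDual ℝ (EuclideanSpace ℝ (Fin d))).symm.continuous.comp_continuousOn
    (hf.continuousOn_fderivWithin hΩ.uniqueDiffOn le_rfl)

lemma IsSmoothBoundedDomain.integrableOn_of_eqOn (hΩ : IsSmoothBoundedDomain Ω)
    {f g : EuclideanSpace ℝ (Fin d) → ℝ} (hg : ContinuousOn g (closure Ω))
    (hfg : ∀ x ∈ Ω, f x = g x) : IntegrableOn f Ω :=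
  (hΩ.integrableOn_of_continuousOn hg).congr_fun (fun x hx => (hfg x hx).symm)
    hΩ.isOpen.measurableSet

lemma NeumannZero.zeroFlux {f : EuclideanSpace ℝ (Fin d) → ℝ} (hf : NeumannZero Ω f) :
    ZeroFlux Ω (gradientWithin f (closure Ω)) := by
  intro p hp ν hν
  rw [inner_gradientWithin_left]
  exact hf p hp ν hν

lemma ZeroFlux.add {F G : EuclideanSpace ℝ (Fin d) → EuclideanSpace ℝ (Fin d)}
    (hF : ZeroFlux Ω F) (hG : ZeroFlux Ω G) : ZeroFlux Ω fun x => F x + G x := by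
  intro p hp ν hν
  rw [inner_add_left, hF p hp ν hν, hG p hp ν hν, add_zero]

lemma ZeroFlux.smul {F : EuclideanSpace ℝ (Fin d) → EuclideanSpace ℝ (Fin d)}
    (hF : ZeroFlux Ω F) (u : EuclideanSpace ℝ (Fin d) → ℝ) :
    ZeroFlux Ω fun x => u x • F x := by
  intro p hp ν hν
  rw [inner_smul_left, hF p hp ν hν, mul_zero]

lemma differentiableAt_of_contDiffOn_closure {G : Type*} [NormedAddCommGroup G] [NormedSpace ℝ G]
    (hΩ : IsOpen Ω) {f : EuclideanSpace ℝ (Fin d) → G} {n : ℕ} (hn : n ≠ 0)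
    (hf : ContDiffOn ℝ n f (closure Ω)) {x : EuclideanSpace ℝ (Fin d)} (hx : x ∈ Ω) :
    DifferentiableAt ℝ f x :=
  (hf.contDiffAt (mem_of_superset (hΩ.mem_nhds hx) subset_closure)).differentiableAt
    (by exact_mod_cast hn)

/-- **Green's formula** for a tangential field. -/
theorem IsSmoothBoundedDomain.integral_mul_divergence (hΩ : IsSmoothBoundedDomain Ω)
    {u : EuclideanSpace ℝ (Fin d) → ℝ} (hu : ContDiffOn ℝ 1 u (closure Ω))
    {F : EuclideanSpace ℝ (Fin d) → EuclideanSpace ℝ (Fin d)}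
    (hF : ContDiffOn ℝ 1 F (closure Ω)) (hflux : ZeroFlux Ω F) :
    ∫ x in Ω, u x * divergence F x = -∫ x in Ω, inner ℝ (gradient u x) (F x) := by
  have h0 := hΩ.integral_divergence_eq_zero (hu.smul hF) (hflux.smul u)
  have heq : ∀ x ∈ Ω, divergence (fun y => u y • F y) x =
      u x * divergence F x + inner ℝ (gradient u x) (F x) := by
    intro x hx
    rw [divergence_smul (differentiableAt_of_contDiffOn_closure hΩ.isOpen (n := 1) one_ne_zero
      (by exact_mod_cast hu) hx) (differentiableAt_of_contDiffOn_closure hΩ.isOpen (n := 1)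
      one_ne_zero (by exact_mod_cast hF) hx), inner_gradient_left]
  have hint : IntegrableOn (fun x => inner ℝ (gradient u x) (F x)) Ω :=
    hΩ.integrableOn_of_eqOn ((hΩ.continuousOn_gradientWithin hu).inner (𝕜 := ℝ) hF.continuousOn)
      fun x hx => by simp only [gradientWithin_closure_eq hΩ.isOpen u hx]
  change ∫ x in Ω, divergence (fun y => u y • F y) x = 0 at h0
  rw [setIntegral_congr_fun hΩ.isOpen.measurableSet heq, integral_add
    (hΩ.integrableOn_mul_divergence hF hu.continuousOn) hint] at h0
  linarith

/-- Links Poisson's equation, written with the Laplacian, to Green's formula: both sides are the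
trace of the second derivative in the standard basis. -/
lemma IsSmoothBoundedDomain.divergence_gradientWithin (hΩ : IsSmoothBoundedDomain Ω)
    {f : EuclideanSpace ℝ (Fin d) → ℝ} (hf : ContDiffOn ℝ 2 f (closure Ω))
    {x : EuclideanSpace ℝ (Fin d)} (hx : x ∈ Ω) :
    divergence (gradientWithin f (closure Ω)) x = Laplacian.laplacian f x := by
  have heq : gradientWithin f (closure Ω) =ᶠ[𝓝 x] gradient f := by
    filter_upwards [hΩ.isOpen.mem_nhds hx] with y hy
    exact gradientWithin_closure_eq hΩ.isOpen f hy
  have hfx : ContDiffAt ℝ 2 f x :=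
    hf.contDiffAt (mem_of_superset (hΩ.isOpen.mem_nhds hx) subset_closure)
  have hd : DifferentiableAt ℝ (fderiv ℝ f) x :=
    (hfx.fderiv_right (m := 1) (by norm_num)).differentiableAt (by simp)
  rw [divergence_congr heq, InnerProductSpace.laplacian_eq_iteratedFDeriv_orthonormalBasis f
    (EuclideanSpace.basisFun (Fin d) ℝ)]
  refine Finset.sum_congr rfl fun j _ => ?_
  have hg : DifferentiableAt ℝ (gradient f) x :=
    (differentiableAt_of_contDiffOn_closure hΩ.isOpen one_ne_zero
      (by exact_mod_cast hΩ.contDiffOn_gradientWithin hf) hx).congr_of_eventuallyEq heq.symm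
  have hcoord : (fun y => gradient f y j) =
      fun y => fderiv ℝ f y (EuclideanSpace.single j (1 : ℝ)) := by
    funext y
    rw [← inner_gradient_left (𝕜 := ℝ)]
    generalize gradient f y = v
    simp [EuclideanSpace.inner_single_right]
  have h1 : HasFDerivAt (fun y => gradient f y j)
      ((EuclideanSpace.proj j : EuclideanSpace ℝ (Fin d) →L[ℝ] ℝ).comp
        (fderiv ℝ (gradient f) x)) x :=
    (EuclideanSpace.proj (𝕜 := ℝ) j).hasFDerivAt.comp x hg.hasFDerivAt
  have h2 := hd.hasFDerivAt.clm_apply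
    (hasFDerivAt_const (EuclideanSpace.single j (1 : ℝ) : EuclideanSpace ℝ (Fin d)) x)
  rw [← hcoord] at h2
  have h3 := congrArg (fun L : EuclideanSpace ℝ (Fin d) →L[ℝ] ℝ =>
    L (EuclideanSpace.single j (1 : ℝ))) (h1.unique h2)
  rw [iteratedFDeriv_two_apply]
  simpa using h3

/-! ### Integrals depending on time -/

lemma exists_abs_le_of_continuousOn (hK : IsCompact (closure Ω)) {J I : Set ℝ} (hI : IsCompact I)
    (hIJ : I ⊆ J) {f : ℝ → EuclideanSpace ℝ (Fin d) → ℝ}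
    (hf : ContinuousOn (fun q : ℝ × EuclideanSpace ℝ (Fin d) => f q.1 q.2) (J ×ˢ closure Ω)) :
    ∃ K : ℝ, 0 ≤ K ∧ ∀ s ∈ I, ∀ x ∈ closure Ω, |f s x| ≤ K := by
  obtain ⟨K, hKb⟩ := (hI.prod hK).exists_bound_of_continuousOn
    (hf.mono (prod_mono hIJ subset_rfl))
  exact ⟨max K 0, le_max_right _ _, fun s hs x hx =>
    (hKb (s, x) ⟨hs, hx⟩).trans (le_max_left _ _)⟩

lemma continuousOn_slice {J : Set ℝ} {f : ℝ → EuclideanSpace ℝ (Fin d) → ℝ}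
    (hf : ContinuousOn (fun q : ℝ × EuclideanSpace ℝ (Fin d) => f q.1 q.2) (J ×ˢ closure Ω))
    {t : ℝ} (ht : t ∈ J) : ContinuousOn (f t) (closure Ω) :=
  hf.comp (f := fun x => (t, x)) (by fun_prop) fun _ hx => ⟨ht, hx⟩

lemma continuousOn_time_slice {J : Set ℝ} {f : ℝ → EuclideanSpace ℝ (Fin d) → ℝ}
    (hf : ContinuousOn (fun q : ℝ × EuclideanSpace ℝ (Fin d) => f q.1 q.2) (J ×ˢ closure Ω))
    {x : EuclideanSpace ℝ (Fin d)} (hx : x ∈ closure Ω) : ContinuousOn (fun t => f t x) J :=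
  hf.comp (f := fun t => (t, x)) (by fun_prop) fun _ ht => ⟨ht, hx⟩

lemma IsSmoothBoundedDomain.continuousOn_setIntegral (hΩ : IsSmoothBoundedDomain Ω)
    {f : ℝ → EuclideanSpace ℝ (Fin d) → ℝ}
    (hf : ContinuousOn (fun q : ℝ × EuclideanSpace ℝ (Fin d) => f q.1 q.2)
      (Ici 0 ×ˢ closure Ω)) : ContinuousOn (fun t => ∫ x in Ω, f t x) (Ici 0) := by
  intro t ht
  obtain ⟨K, hK0, hK⟩ := exists_abs_le_of_continuousOn hΩ.isCompact_closure
    (isCompact_Icc (a := (0 : ℝ)) (b := t + 1)) (fun s hs => hs.1) hf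
  refine continuousWithinAt_of_dominated (bound := fun _ => K) ?_ ?_ ?_ ?_
  · filter_upwards [self_mem_nhdsWithin] with s hs
    exact (hΩ.integrableOn_of_continuousOn (continuousOn_slice hf hs)).aestronglyMeasurable
  · filter_upwards [self_mem_nhdsWithin,
      mem_nhdsWithin_of_mem_nhds (Iio_mem_nhds (lt_add_one t))] with s hs hs'
    exact (ae_restrict_mem hΩ.isOpen.measurableSet).mono fun x hx =>
      hK s ⟨hs, le_of_lt hs'⟩ x (subset_closure hx)
  · exact hΩ.integrableOn_of_continuousOn continuousOn_const
  · exact (ae_restrict_mem hΩ.isOpen.measurableSet).mono fun x hx =>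
      continuousOn_time_slice hf (subset_closure hx) t ht

/-- Differentiation of a function whose increments are `∫ (w s + w t) (ρ s - ρ t)`; only `ρ` has to
be differentiable in time. -/
lemma IsSmoothBoundedDomain.hasDerivAt_of_sub_eq_setIntegral (hΩ : IsSmoothBoundedDomain Ω)
    {A : ℝ → ℝ} {w ρ ρ' : ℝ → EuclideanSpace ℝ (Fin d) → ℝ}
    (hw : ContinuousOn (fun q : ℝ × EuclideanSpace ℝ (Fin d) => w q.1 q.2) (Ioi 0 ×ˢ closure Ω))
    (hρc : ∀ t > 0, ContinuousOn (ρ t) (closure Ω))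
    (hρ' : ContinuousOn (fun q : ℝ × EuclideanSpace ℝ (Fin d) => ρ' q.1 q.2) (Ioi 0 ×ˢ closure Ω))
    (hρ : ∀ t > 0, ∀ x ∈ closure Ω, HasDerivAt (fun s => ρ s x) (ρ' t x) t) {t : ℝ} (ht : 0 < t)
    (hA : ∀ s > 0, A s - A t = ∫ x in Ω, (w s x + w t x) * (ρ s x - ρ t x)) :
    HasDerivAt A (∫ x in Ω, 2 * w t x * ρ' t x) t := by
  have hI : Icc (t / 2) (2 * t) ⊆ Ioi 0 := fun s hs =>
    lt_of_lt_of_le (by positivity) hs.1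
  have htI : t ∈ Icc (t / 2) (2 * t) := ⟨by linarith, by linarith⟩
  obtain ⟨B, hB0, hB⟩ := exists_abs_le_of_continuousOn hΩ.isCompact_closure isCompact_Icc hI hw
  obtain ⟨K, hK0, hK⟩ := exists_abs_le_of_continuousOn hΩ.isCompact_closure isCompact_Icc hI hρ'
  have hnear : ∀ᶠ s in 𝓝[≠] t, s ∈ Icc (t / 2) (2 * t) :=
    mem_nhdsWithin_of_mem_nhds (Icc_mem_nhds (by linarith) (by linarith))
  rw [hasDerivAt_iff_tendsto_slope]
  have hslope : ∀ᶠ s in 𝓝[≠] t,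
      ∫ x in Ω, (w s x + w t x) * slope (fun r => ρ r x) t s = slope A t s := by
    filter_upwards [hnear] with s hs
    rw [slope_def_module, hA s (hI hs), smul_eq_mul, ← integral_const_mul]
    refine integral_congr_ae (Eventually.of_forall fun x => ?_)
    simp only [slope_def_module, smul_eq_mul]
    ring
  refine Tendsto.congr' hslope ?_
  refine tendsto_integral_filter_of_dominated_convergence (fun _ => 2 * B * K) ?_ ?_ ?_ ?_
  · filter_upwards [hnear] with s hs
    simp only [slope_def_module]
    refine (hΩ.integrableOn_of_continuousOn ?_).aestronglyMeasurable
    have hsub : ContinuousOn (fun x => (s - t)⁻¹ • (ρ s x - ρ t x)) (closure Ω) :=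
      continuousOn_const.smul (f := fun _ => (s - t)⁻¹) (g := fun x => ρ s x - ρ t x)
        ((hρc s (hI hs)).sub (hρc t ht))
    exact ((continuousOn_slice hw (hI hs)).add (continuousOn_slice hw ht)).mul hsub
  · filter_upwards [hnear, self_mem_nhdsWithin] with s hs hst
    refine (ae_restrict_mem hΩ.isOpen.measurableSet).mono fun x hx => ?_
    have hx' := subset_closure hx
    rw [norm_mul, Real.norm_eq_abs, Real.norm_eq_abs]
    refine mul_le_mul ?_ ?_ (abs_nonneg _) (by positivity)
    · exact (abs_add_le _ _).trans (by linarith [hB s hs x hx', hB t htI x hx'])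
    -- The mean value inequality in time bounds every difference quotient of `ρ` by the supremum of
    -- `ρ'` on the compact time window.
    · have := (convex_Icc (t / 2) (2 * t)).norm_image_sub_le_of_norm_hasDerivWithin_le
        (f := fun r => ρ r x) (f' := fun r => ρ' r x) (C := K)
        (fun r hr => (hρ r (hI hr) x hx').hasDerivWithinAt) (fun r hr => hK r hr x hx') htI hs
      have hpos : 0 < |s - t| := abs_pos.2 (sub_ne_zero.2 hst)
      rw [slope_def_field, abs_div, div_le_iff₀ hpos]
      exact this
  · exact hΩ.integrableOn_of_continuousOn continuousOn_const
  · refine (ae_restrict_mem hΩ.isOpen.measurableSet).mono fun x hx => ?_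
    have hx' := subset_closure hx
    have h1 : Tendsto (fun s => w s x) (𝓝[≠] t) (𝓝 (w t x)) :=
      ((continuousOn_time_slice hw hx').continuousAt (Ioi_mem_nhds ht)).tendsto.mono_left
        nhdsWithin_le_nhds
    have h2 := hasDerivAt_iff_tendsto_slope.1 (hρ t ht x hx')
    have h3 := (h1.add_const (w t x)).mul h2
    rwa [← two_mul] at h3

lemma IsSmoothBoundedDomain.hasDerivAt_setIntegral (hΩ : IsSmoothBoundedDomain Ω)
    {ρ ρ' : ℝ → EuclideanSpace ℝ (Fin d) → ℝ}
    (hρc : ∀ t > 0, ContinuousOn (ρ t) (closure Ω))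
    (hρ' : ContinuousOn (fun q : ℝ × EuclideanSpace ℝ (Fin d) => ρ' q.1 q.2) (Ioi 0 ×ˢ closure Ω))
    (hρ : ∀ t > 0, ∀ x ∈ closure Ω, HasDerivAt (fun s => ρ s x) (ρ' t x) t) {t : ℝ} (ht : 0 < t) :
    HasDerivAt (fun s => ∫ x in Ω, ρ s x) (∫ x in Ω, ρ' t x) t := by
  have := hΩ.hasDerivAt_of_sub_eq_setIntegral (A := fun s => ∫ x in Ω, ρ s x)
    -- This weight makes `w s + w t = 1`, so the increment is the plain one.
    (w := fun _ _ => 1 / 2) continuousOn_const hρc hρ' hρ ht (fun s hs => by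
      rw [← integral_sub (hΩ.integrableOn_of_continuousOn (hρc s hs))
        (hΩ.integrableOn_of_continuousOn (hρc t ht))]
      norm_num)
  simpa using this

/-! ### Gradient computations for the electrochemical potential -/

/-- The constant `K` leaves room for the normalization of the entropy in the test function. -/
lemma gradient_log_add {f Ψ : EuclideanSpace ℝ (Fin d) → ℝ} {x : EuclideanSpace ℝ (Fin d)}
    (hf : DifferentiableAt ℝ f x) (hΨ : DifferentiableAt ℝ Ψ x) (hpos : 0 < f x) (ζ K : ℝ) :
    gradient (fun y => Real.log (f y) + ζ * Ψ y + K) x =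
      (f x)⁻¹ • gradient f x + ζ • gradient Ψ x := by
  refine ext_inner_right ℝ fun v => ?_
  have h : HasFDerivAt (fun y => Real.log (f y) + ζ * Ψ y + K) _ x :=
    ((hf.hasFDerivAt.log hpos.ne').add (hΨ.hasFDerivAt.const_mul ζ)).add_const K
  rw [inner_gradient_left, h.fderiv, inner_add_left, inner_smul_left, inner_smul_left,
    inner_gradient_left, inner_gradient_left]
  simp

lemma gradient_sqrt {f : EuclideanSpace ℝ (Fin d) → ℝ} {x : EuclideanSpace ℝ (Fin d)}
    (hf : DifferentiableAt ℝ f x) (hpos : 0 < f x) :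
    gradient (fun y => Real.sqrt (f y)) x = (1 / (2 * Real.sqrt (f x))) • gradient f x := by
  refine ext_inner_right ℝ fun v => ?_
  rw [inner_gradient_left, (hf.hasFDerivAt.sqrt hpos.ne').fderiv, inner_smul_left,
    inner_gradient_left]
  simp

lemma four_mul_norm_gradient_sqrt_sq {f : EuclideanSpace ℝ (Fin d) → ℝ}
    {x : EuclideanSpace ℝ (Fin d)} (hf : DifferentiableAt ℝ f x) (hpos : 0 < f x) :
    4 * ‖gradient (fun y => Real.sqrt (f y)) x‖ ^ 2 = (f x)⁻¹ * ‖gradient f x‖ ^ 2 := by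
  rw [gradient_sqrt hf hpos, norm_smul, mul_pow, Real.norm_eq_abs, sq_abs, div_pow, mul_pow,
    Real.sq_sqrt hpos.le]
  field_simp
  norm_num

/-- Expands the square of `∇f / f + ζ ∇Ψ`; the first term on the right is `4|∇√f|²`. -/
lemma mul_norm_gradient_log_add_sq {f Ψ : EuclideanSpace ℝ (Fin d) → ℝ}
    {x : EuclideanSpace ℝ (Fin d)} (hf : DifferentiableAt ℝ f x) (hΨ : DifferentiableAt ℝ Ψ x)
    (hpos : 0 < f x) (ζ : ℝ) :
    f x * ‖gradient (fun y => Real.log (f y) + ζ * Ψ y) x‖ ^ 2 =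
      (f x)⁻¹ * ‖gradient f x‖ ^ 2 + 2 * ζ * inner ℝ (gradient f x) (gradient Ψ x) +
        ζ ^ 2 * f x * ‖gradient Ψ x‖ ^ 2 := by
  have h := gradient_log_add hf hΨ hpos ζ 0
  simp only [add_zero] at h
  rw [h, norm_add_sq_real, norm_smul, norm_smul, mul_pow, mul_pow, real_inner_smul_left,
    real_inner_smul_right, Real.norm_eq_abs, Real.norm_eq_abs, sq_abs, sq_abs]
  field_simp

lemma IsSmoothBoundedDomain.differentiableAt (hΩ : IsSmoothBoundedDomain Ω)
    {f : EuclideanSpace ℝ (Fin d) → ℝ} (hf : ContDiffOn ℝ 2 f (closure Ω)) {x : EuclideanSpace ℝ (Fin d)} (hx : x ∈ Ω) :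
    DifferentiableAt ℝ f x :=
  differentiableAt_of_contDiffOn_closure hΩ.isOpen two_ne_zero (by exact_mod_cast hf) hx

lemma IsSmoothBoundedDomain.integrableOn_mul_inner_gradient (hΩ : IsSmoothBoundedDomain Ω)
    {f g h : EuclideanSpace ℝ (Fin d) → ℝ} (hf : ContinuousOn f (closure Ω))
    (hg : ContDiffOn ℝ 1 g (closure Ω)) (hh : ContDiffOn ℝ 1 h (closure Ω)) :
    IntegrableOn (fun x => f x * inner ℝ (gradient g x) (gradient h x)) Ω :=
  hΩ.integrableOn_of_eqOn
    (g := fun x => f x * inner ℝ (gradientWithin g (closure Ω) x) (gradientWithin h (closure Ω) x))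
    (hf.mul ((hΩ.continuousOn_gradientWithin hg).inner (𝕜 := ℝ)
    (hΩ.continuousOn_gradientWithin hh)))
    fun x hx => by simp only [gradientWithin_closure_eq hΩ.isOpen _ hx]

lemma IsSmoothBoundedDomain.integrableOn_mul_norm_gradient_sq (hΩ : IsSmoothBoundedDomain Ω)
    {f g : EuclideanSpace ℝ (Fin d) → ℝ} (hf : ContinuousOn f (closure Ω))
    (hg : ContDiffOn ℝ 1 g (closure Ω)) :
    IntegrableOn (fun x => f x * ‖gradient g x‖ ^ 2) Ω := by
  simpa only [real_inner_self_eq_norm_sq] using hΩ.integrableOn_mul_inner_gradient hf hg hg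

lemma integrableOn_norm_gradient_sqrt_sq {f : EuclideanSpace ℝ (Fin d) → ℝ}
    (hΩ : IsSmoothBoundedDomain Ω) (hf : ContDiffOn ℝ 2 f (closure Ω))
    (hpos : ∀ x ∈ closure Ω, 0 < f x) :
    IntegrableOn (fun x => ‖gradient (fun y => Real.sqrt (f y)) x‖ ^ 2) Ω := by
  have hinv : ContinuousOn (fun x => (1 / 4) * (f x)⁻¹) (closure Ω) :=
    continuousOn_const.mul (hf.continuousOn.inv₀ fun x hx => (hpos x hx).ne')
  refine (hΩ.integrableOn_mul_norm_gradient_sq hinv (hf.of_le (by norm_num))).congr_fun ?_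
    hΩ.isOpen.measurableSet
  intro x hx
  have := four_mul_norm_gradient_sqrt_sq (hΩ.differentiableAt hf hx) (hpos x (subset_closure hx))
  simp only
  linarith

lemma integrableOn_mul_norm_gradient_log_add_sq {f Ψ : EuclideanSpace ℝ (Fin d) → ℝ}
    (hΩ : IsSmoothBoundedDomain Ω) (hf : ContDiffOn ℝ 2 f (closure Ω))
    (hpos : ∀ x ∈ closure Ω, 0 < f x) (hΨ : ContDiffOn ℝ 2 Ψ (closure Ω))
    (ζ : ℝ) :
    IntegrableOn (fun x => f x * ‖gradient (fun y => Real.log (f y) + ζ * Ψ y) x‖ ^ 2) Ω := by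
  refine hΩ.integrableOn_mul_norm_gradient_sq hf.continuousOn ?_
  exact ((hf.of_le (by norm_num)).log fun x hx => (hpos x hx).ne').add
    (contDiffOn_const.mul (hΨ.of_le (by norm_num)))

/-- The dissipation of one species splits into diffusive, mixed and migrational parts. -/
lemma integral_mul_norm_gradient_log_add_sq {f Ψ : EuclideanSpace ℝ (Fin d) → ℝ}
    (hΩ : IsSmoothBoundedDomain Ω) (hf : ContDiffOn ℝ 2 f (closure Ω))
    (hpos : ∀ x ∈ closure Ω, 0 < f x) (hΨ : ContDiffOn ℝ 2 Ψ (closure Ω))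
    (ζ : ℝ) :
    ∫ x in Ω, f x * ‖gradient (fun y => Real.log (f y) + ζ * Ψ y) x‖ ^ 2 =
      (∫ x in Ω, 4 * ‖gradient (fun y => Real.sqrt (f y)) x‖ ^ 2) +
        2 * ζ * (∫ x in Ω, inner ℝ (gradient f x) (gradient Ψ x)) +
        ∫ x in Ω, ζ ^ 2 * f x * ‖gradient Ψ x‖ ^ 2 := by
  have hf1 : ContDiffOn ℝ 1 f (closure Ω) := hf.of_le (by norm_num)
  have hΨ1 : ContDiffOn ℝ 1 Ψ (closure Ω) := hΨ.of_le (by norm_num)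
  have h1 : IntegrableOn (fun x => 4 * ‖gradient (fun y => Real.sqrt (f y)) x‖ ^ 2) Ω :=
    (integrableOn_norm_gradient_sqrt_sq hΩ hf hpos).const_mul 4
  have h2 : IntegrableOn (fun x => 2 * ζ * inner ℝ (gradient f x) (gradient Ψ x)) Ω :=
    hΩ.integrableOn_mul_inner_gradient continuousOn_const hf1 hΨ1
  have h3 : IntegrableOn (fun x => ζ ^ 2 * f x * ‖gradient Ψ x‖ ^ 2) Ω :=
    hΩ.integrableOn_mul_norm_gradient_sq (continuousOn_const.mul hf.continuousOn) hΨ1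
  have h12 : IntegrableOn (fun x => 4 * ‖gradient (fun y => Real.sqrt (f y)) x‖ ^ 2 +
      2 * ζ * inner ℝ (gradient f x) (gradient Ψ x)) Ω := h1.add h2
  rw [← integral_const_mul, ← integral_add h1 h2, ← integral_add h12 h3]
  refine setIntegral_congr_fun hΩ.isOpen.measurableSet fun x hx => ?_
  have hfx := hΩ.differentiableAt hf hx
  have hx' := hpos x (subset_closure hx)
  rw [four_mul_norm_gradient_sqrt_sq hfx hx',
    mul_norm_gradient_log_add_sq hfx (hΩ.differentiableAt hΨ hx) hx']

/-- The Nernst–Planck flux tested with the electrochemical potential. -/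
lemma integral_potential_mul_divergence_flux {f Ψ : EuclideanSpace ℝ (Fin d) → ℝ}
    (hΩ : IsSmoothBoundedDomain Ω) (hf : ContDiffOn ℝ 2 f (closure Ω))
    (hpos : ∀ x ∈ closure Ω, 0 < f x) (hΨ : ContDiffOn ℝ 2 Ψ (closure Ω))
    (hfN : NeumannZero Ω f) (hΨN : NeumannZero Ω Ψ)
    (ζ K : ℝ) :
    ∫ x in Ω, (Real.log (f x) + ζ * Ψ x + K) *
        divergence (fun y => gradientWithin f (closure Ω) y +
          (ζ * f y) • gradientWithin Ψ (closure Ω) y) x =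
      -∫ x in Ω, f x * ‖gradient (fun y => Real.log (f y) + ζ * Ψ y) x‖ ^ 2 := by
  have hf1 : ContDiffOn ℝ 1 f (closure Ω) := hf.of_le (by norm_num)
  have hΨ1 : ContDiffOn ℝ 1 Ψ (closure Ω) := hΨ.of_le (by norm_num)
  rw [hΩ.integral_mul_divergence (u := fun x => Real.log (f x) + ζ * Ψ x + K)
    (F := fun y => gradientWithin f (closure Ω) y + (ζ * f y) • gradientWithin Ψ (closure Ω) y)
    (((hf1.log fun x hx => (hpos x hx).ne').add (contDiffOn_const.mul hΨ1)).add contDiffOn_const)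
    ((hΩ.contDiffOn_gradientWithin hf).add
      ((contDiffOn_const.mul hf1).smul (hΩ.contDiffOn_gradientWithin hΨ)))
    (hfN.zeroFlux.add (hΨN.zeroFlux.smul _))]
  congr 1
  refine setIntegral_congr_fun hΩ.isOpen.measurableSet fun x hx => ?_
  have hfx := hΩ.differentiableAt hf hx
  have hΨx := hΩ.differentiableAt hΨ hx
  have hx' := hpos x (subset_closure hx)
  have h0 := gradient_log_add hfx hΨx hx' ζ 0
  simp only [add_zero] at h0
  -- The flux is `f` times the gradient of the potential, so pairing the two produces a square.
  have hflux : gradient f x + (ζ * f x) • gradient Ψ x =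
      f x • ((f x)⁻¹ • gradient f x + ζ • gradient Ψ x) := by
    rw [smul_add, smul_smul, smul_smul, mul_inv_cancel₀ hx'.ne', one_smul, mul_comm]
  simp only [gradientWithin_closure_eq hΩ.isOpen _ hx]
  rw [gradient_log_add hfx hΨx hx', h0, hflux, real_inner_smul_right, real_inner_self_eq_norm_sq]

/-! ### Consequences of the Nernst–Planck–Poisson system -/

namespace IsClassicalSolution

variable {N : ℕ} {Dc z : Fin N → ℝ} {ε : ℝ}
  {c : Fin N → ℝ → EuclideanSpace ℝ (Fin d) → ℝ} {Φ : ℝ → EuclideanSpace ℝ (Fin d) → ℝ}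

lemma contDiffOn_conc (h : IsClassicalSolution Ω Dc z ε c Φ) (i : Fin N) {t : ℝ} (ht : 0 < t) :
    ContDiffOn ℝ 2 (c i t) (closure Ω) := by
  exact_mod_cast (h.conc_spatial i).1 t ht

lemma contDiffOn_pot (h : IsClassicalSolution Ω Dc z ε c Φ) {t : ℝ} (ht : 0 < t) :
    ContDiffOn ℝ 2 (Φ t) (closure Ω) := by
  exact_mod_cast h.pot_C2.1 t ht

lemma contDiffOn_one_pot (h : IsClassicalSolution Ω Dc z ε c Φ) {t : ℝ} (ht : 0 ≤ t) :
    ContDiffOn ℝ 1 (Φ t) (closure Ω) := by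
  exact_mod_cast h.pot_C1.1 t ht

lemma continuousOn_conc (h : IsClassicalSolution Ω Dc z ε c Φ) (i : Fin N) :
    ContinuousOn (fun q : ℝ × EuclideanSpace ℝ (Fin d) => c i q.1 q.2) (Ioi 0 ×ˢ closure Ω) :=
  (h.conc_continuous i).mono (prod_mono Ioi_subset_Ici_self subset_rfl)

lemma continuousOn_pot (h : IsClassicalSolution Ω Dc z ε c Φ) :
    ContinuousOn (fun q : ℝ × EuclideanSpace ℝ (Fin d) => Φ q.1 q.2) (Ici 0 ×ˢ closure Ω) := by
  have h0 := h.pot_C1.2 0 (by norm_num)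
  have h1 := (ContinuousMultilinearMap.apply ℝ (fun _ : Fin 0 => EuclideanSpace ℝ (Fin d)) ℝ
    (fun _ => 0)).continuous.comp_continuousOn h0
  exact h1.congr fun q _ => by simp

lemma hasDerivAt_conc (h : IsClassicalSolution Ω Dc z ε c Φ) (i : Fin N) :
    ∀ t > 0, ∀ x ∈ closure Ω,
      HasDerivAt (fun s => c i s x) (deriv (fun s => c i s x) t) t :=
  fun t ht x hx => ((h.conc_time i).1 t ht x hx).hasDerivAt

lemma continuousOn_deriv_conc (h : IsClassicalSolution Ω Dc z ε c Φ) (i : Fin N) {t : ℝ}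
    (ht : 0 < t) : ContinuousOn (fun x => deriv (fun s => c i s x) t) (closure Ω) :=
  continuousOn_slice (J := Ioi 0) (f := fun t x => deriv (fun s => c i s x) t)
    (h.conc_time i).2 ht

lemma continuousOn_charge (h : IsClassicalSolution Ω Dc z ε c Φ) {t : ℝ} (ht : 0 ≤ t) :
    ContinuousOn (chargeDensity z c t) (closure Ω) :=
  continuousOn_finsetSum _ fun i _ =>
    continuousOn_const.mul (continuousOn_slice (h.conc_continuous i) ht)

lemma deriv_conc_eq (hΩ : IsSmoothBoundedDomain Ω) (h : IsClassicalSolution Ω Dc z ε c Φ)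
    (i : Fin N) {t : ℝ} (ht : 0 < t) {x : EuclideanSpace ℝ (Fin d)} (hx : x ∈ Ω) :
    deriv (fun s => c i s x) t = Dc i * divergence (fun y => gradientWithin (c i t) (closure Ω) y +
      (z i * c i t y) • gradientWithin (Φ t) (closure Ω) y) x := by
  rw [h.nernst_planck i t ht x hx]
  congr 1
  refine divergence_congr ?_
  filter_upwards [hΩ.isOpen.mem_nhds hx] with y hy
  simp only [gradientWithin_closure_eq hΩ.isOpen _ hy]

/-- The total mass of each species is conserved. -/
lemma integral_conc_eq (hΩ : IsSmoothBoundedDomain Ω) (h : IsClassicalSolution Ω Dc z ε c Φ)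
    (i : Fin N) {t : ℝ} (ht : 0 < t) : ∫ x in Ω, c i t x = ∫ x in Ω, c i 0 x := by
  have hder : ∀ s > 0, HasDerivAt (fun s => ∫ x in Ω, c i s x) 0 s := by
    intro s hs
    have h1 := hΩ.hasDerivAt_setIntegral (fun s hs => continuousOn_slice (h.continuousOn_conc i) hs)
      (h.conc_time i).2 (h.hasDerivAt_conc i) hs
    convert h1 using 1
    rw [setIntegral_congr_fun hΩ.isOpen.measurableSet fun x hx => h.deriv_conc_eq hΩ i hs hx,
      integral_const_mul, hΩ.integral_divergence_eq_zero, mul_zero]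
    · exact (hΩ.contDiffOn_gradientWithin (h.contDiffOn_conc i hs)).add
        ((contDiffOn_const.mul ((h.contDiffOn_conc i hs).of_le (by norm_num))).smul
          (hΩ.contDiffOn_gradientWithin (h.contDiffOn_pot hs)))
    · exact (h.conc_neumann i s hs).zeroFlux.add ((h.pot_neumann s hs).zeroFlux.smul _)
  -- The derivative is known only for positive times; the mean value theorem needs mere continuity
  -- at time `0`.
  obtain ⟨s, hs, heq⟩ := exists_hasDerivAt_eq_slope _ (fun _ => (0 : ℝ)) ht
    ((hΩ.continuousOn_setIntegral (h.conc_continuous i)).mono Icc_subset_Ici_self)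
    (fun s hs => hder s hs.1)
  rw [eq_comm, div_eq_zero_iff] at heq
  rcases heq with heq | heq <;> linarith

/-- Positivity of the concentrations is assumed only for positive times, so it is taken at time `1`
and carried back by mass conservation. -/
lemma initialMean_pos (hΩ : IsSmoothBoundedDomain Ω) (h : IsClassicalSolution Ω Dc z ε c Φ)
    (i : Fin N) : 0 < initialMean Ω c i := by
  have hvol : 0 < volume Ω := hΩ.isOpen.measure_pos volume hΩ.isConnected.nonempty
  have hfin : volume Ω ≠ ⊤ := hΩ.isBounded.measure_lt_top.ne
  rw [initialMean, setAverage_eq, ← h.integral_conc_eq hΩ i one_pos, smul_eq_mul]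
  refine mul_pos (inv_pos.2 (ENNReal.toReal_pos hvol.ne' hfin)) ?_
  have hint : IntegrableOn (c i 1) Ω :=
    hΩ.integrableOn_of_continuousOn (continuousOn_slice (h.continuousOn_conc i) (mem_Ioi.2 one_pos))
  refine (setIntegral_pos_iff_support_of_nonneg_ae ?_ hint).2 ?_
  · exact (ae_restrict_mem hΩ.isOpen.measurableSet).mono fun x hx =>
      (h.conc_pos i 1 one_pos x (subset_closure hx)).le
  · have hsupp : Ω ⊆ Function.support (c i 1) := fun x hx =>
      (h.conc_pos i 1 one_pos x (subset_closure hx)).ne'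
    rwa [inter_eq_right.2 hsupp]

/-! ### Continuity and time derivative of the energy. -/

lemma continuousOn_entropy (h : IsClassicalSolution Ω Dc z ε c Φ) (hΩ : IsSmoothBoundedDomain Ω)
    (i : Fin N) : ContinuousOn (fun q : ℝ × EuclideanSpace ℝ (Fin d) =>
      c i q.1 q.2 * Real.log (c i q.1 q.2 / initialMean Ω c i)) (Ici 0 ×ˢ closure Ω) := by
  set m := initialMean Ω c i with hm_def
  have hm : 0 < m := h.initialMean_pos hΩ i
  -- Initial concentrations may vanish. With `Real.log 0 = 0` the function `r log r` is continuous
  -- at `0` too, and rescaling by `m` reduces to it.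
  have h1 : Continuous fun r : ℝ => m * ((r / m) * Real.log (r / m)) :=
    continuous_const.mul (Real.continuous_mul_log.comp (continuous_id.div_const m))
  refine (h1.comp_continuousOn (h.conc_continuous i)).congr fun q _ => ?_
  simp only [Function.comp]
  field_simp

lemma continuousOn_norm_gradient_pot_sq (h : IsClassicalSolution Ω Dc z ε c Φ)
    (hΩ : IsSmoothBoundedDomain Ω) : ContinuousOn (fun q : ℝ × EuclideanSpace ℝ (Fin d) =>
      ‖gradientWithin (Φ q.1) (closure Ω) q.2‖ ^ 2) (Ici 0 ×ˢ closure Ω) := by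
  refine ((h.pot_C1.2 1 le_rfl).norm.pow 2).congr fun q hq => ?_
  simp only [Pi.pow_apply]
  rw [norm_iteratedFDerivWithin_one _ (hΩ.uniqueDiffOn _ hq.2), gradientWithin,
    LinearIsometryEquiv.norm_map]

lemma energy_eq (hΩ : IsSmoothBoundedDomain Ω) (t : ℝ) : energy Ω ε c Φ t =
    (∑ i, ∫ x in Ω, c i t x * Real.log (c i t x / initialMean Ω c i)) +
      ε / 2 * ∫ x in Ω, ‖gradientWithin (Φ t) (closure Ω) x‖ ^ 2 := by
  rw [energy, setIntegral_congr_fun hΩ.isOpen.measurableSet fun x hx =>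
    show ‖gradient (Φ t) x‖ ^ 2 = ‖gradientWithin (Φ t) (closure Ω) x‖ ^ 2 by
      rw [gradientWithin_closure_eq hΩ.isOpen _ hx]]

theorem continuousOn_energy (h : IsClassicalSolution Ω Dc z ε c Φ)
    (hΩ : IsSmoothBoundedDomain Ω) : ContinuousOn (energy Ω ε c Φ) (Ici 0) := by
  rw [funext fun t => energy_eq (ε := ε) (c := c) (Φ := Φ) hΩ t]
  exact (continuousOn_finsetSum _ fun i _ =>
    hΩ.continuousOn_setIntegral (h.continuousOn_entropy hΩ i)).add
      (continuousOn_const.mul (hΩ.continuousOn_setIntegral (h.continuousOn_norm_gradient_pot_sq hΩ)))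

lemma hasDerivAt_entropy (h : IsClassicalSolution Ω Dc z ε c Φ) (hΩ : IsSmoothBoundedDomain Ω)
    (i : Fin N) {t : ℝ} (ht : 0 < t) :
    HasDerivAt (fun s => ∫ x in Ω, c i s x * Real.log (c i s x / initialMean Ω c i))
      (∫ x in Ω, deriv (fun s => c i s x) t *
        (Real.log (c i t x / initialMean Ω c i) + 1)) t := by
  have hm := h.initialMean_pos hΩ i
  refine hΩ.hasDerivAt_setIntegral
    (ρ := fun s x => c i s x * Real.log (c i s x / initialMean Ω c i))
    (ρ' := fun t x => deriv (fun s => c i s x) t *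
      (Real.log (c i t x / initialMean Ω c i) + 1)) ?_ ?_ ?_ ht
  · exact fun s hs => continuousOn_slice
      (f := fun s x => c i s x * Real.log (c i s x / initialMean Ω c i))
      (h.continuousOn_entropy hΩ i) (le_of_lt hs)
  · refine (h.conc_time i).2.mul (ContinuousOn.add (ContinuousOn.log
      ((h.continuousOn_conc i).div_const _) ?_) continuousOn_const)
    exact fun q hq => (div_pos (h.conc_pos i q.1 hq.1 q.2 hq.2) hm).ne'
  · intro s hs x hx
    have hpos := h.conc_pos i s hs x hx
    have h1 := h.hasDerivAt_conc i s hs x hx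
    have h2 : HasDerivAt (fun s => c i s x * Real.log (c i s x / initialMean Ω c i)) _ s :=
      h1.mul ((h1.div_const (initialMean Ω c i)).log (div_pos hpos hm).ne')
    convert h2 using 1
    field_simp

lemma divergence_gradientWithin_pot (h : IsClassicalSolution Ω Dc z ε c Φ)
    (hΩ : IsSmoothBoundedDomain Ω) (hε : 0 < ε) {t : ℝ} (ht : 0 < t)
    {x : EuclideanSpace ℝ (Fin d)} (hx : x ∈ Ω) :
    divergence (gradientWithin (Φ t) (closure Ω)) x = -(1 / ε * chargeDensity z c t x) := by
  rw [hΩ.divergence_gradientWithin (h.contDiffOn_pot ht) hx, ← h.poisson t ht x hx]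
  field_simp

/-- Weak form of Poisson's equation; the Neumann condition on `Φ` removes the boundary term. It is
used both with `u` a potential at another time and with `u` a concentration. -/
lemma integral_inner_gradient_pot (h : IsClassicalSolution Ω Dc z ε c Φ)
    (hΩ : IsSmoothBoundedDomain Ω) (hε : 0 < ε) {t : ℝ} (ht : 0 < t)
    {u : EuclideanSpace ℝ (Fin d) → ℝ} (hu : ContDiffOn ℝ 1 u (closure Ω)) :
    ∫ x in Ω, inner ℝ (gradient u x) (gradient (Φ t) x) =
      ∫ x in Ω, u x * (1 / ε * chargeDensity z c t x) := by
  have hg := hΩ.integral_mul_divergence hu (hΩ.contDiffOn_gradientWithin (h.contDiffOn_pot ht))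
    (h.pot_neumann t ht).zeroFlux
  rw [setIntegral_congr_fun hΩ.isOpen.measurableSet fun x hx =>
    show inner ℝ (gradient u x) (gradient (Φ t) x) =
      inner ℝ (gradient u x) (gradientWithin (Φ t) (closure Ω) x) by
        rw [gradientWithin_closure_eq hΩ.isOpen _ hx], eq_comm, ← neg_inj, ← hg, ← integral_neg]
  refine setIntegral_congr_fun hΩ.isOpen.measurableSet fun x hx => ?_
  simp only [h.divergence_gradientWithin_pot hΩ hε ht hx]
  ring

/-- Increments of the field energy, expressed without time derivatives of the potential. -/
lemma field_energy_sub (h : IsClassicalSolution Ω Dc z ε c Φ) (hΩ : IsSmoothBoundedDomain Ω)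
    (hε : 0 < ε) {s t : ℝ} (hs : 0 < s) (ht : 0 < t) :
    (∫ x in Ω, ‖gradient (Φ s) x‖ ^ 2) - ∫ x in Ω, ‖gradient (Φ t) x‖ ^ 2 =
      ∫ x in Ω, (Φ s x + Φ t x) *
        (1 / ε * chargeDensity z c s x - 1 / ε * chargeDensity z c t x) := by
  have hs1 := h.contDiffOn_one_pot hs.le
  have ht1 := h.contDiffOn_one_pot ht.le
  have hint : ∀ a b : ℝ, 0 < a → 0 < b →
      IntegrableOn (fun x => Φ a x * (1 / ε * chargeDensity z c b x)) Ω := fun a b ha hb =>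
    hΩ.integrableOn_of_continuousOn ((h.contDiffOn_one_pot ha.le).continuousOn.mul
      (continuousOn_const.mul (h.continuousOn_charge hb.le)))
  have hself : ∀ a : ℝ, 0 < a → ∫ x in Ω, ‖gradient (Φ a) x‖ ^ 2 =
      ∫ x in Ω, Φ a x * (1 / ε * chargeDensity z c a x) := fun a ha => by
    rw [← h.integral_inner_gradient_pot hΩ hε ha (h.contDiffOn_one_pot ha.le)]
    simp only [real_inner_self_eq_norm_sq]
  -- Reciprocity: both sides equal `∫ ∇Φ(s)·∇Φ(t)`, so the cross terms of the product cancel.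
  have hsymm : ∫ x in Ω, Φ t x * (1 / ε * chargeDensity z c s x) =
      ∫ x in Ω, Φ s x * (1 / ε * chargeDensity z c t x) := by
    rw [← h.integral_inner_gradient_pot hΩ hε hs ht1, ← h.integral_inner_gradient_pot hΩ hε ht hs1]
    simp only [real_inner_comm]
  have hexp : ∀ x, (Φ s x + Φ t x) *
      (1 / ε * chargeDensity z c s x - 1 / ε * chargeDensity z c t x) =
      (Φ s x * (1 / ε * chargeDensity z c s x) - Φ t x * (1 / ε * chargeDensity z c t x)) +
      (Φ t x * (1 / ε * chargeDensity z c s x) - Φ s x * (1 / ε * chargeDensity z c t x)) :=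
    fun x => by ring
  simp only [hexp]
  have hadd := integral_add ((hint s s hs hs).sub (hint t t ht ht))
    ((hint t s ht hs).sub (hint s t hs ht))
  simp only [Pi.sub_apply] at hadd
  rw [hadd, integral_sub (hint s s hs hs) (hint t t ht ht), integral_sub (hint t s ht hs) (hint s t hs ht),
    hsymm, hself s hs, hself t ht]
  ring

/-- With weight `w = Φ`, the increment formula needs only continuity of `Φ` in time; the derivative
falls on the charge. -/
lemma hasDerivAt_field_energy (h : IsClassicalSolution Ω Dc z ε c Φ)
    (hΩ : IsSmoothBoundedDomain Ω) (hε : 0 < ε) {t : ℝ} (ht : 0 < t) :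
    HasDerivAt (fun s => ∫ x in Ω, ‖gradient (Φ s) x‖ ^ 2)
      (2 / ε * ∑ i, ∫ x in Ω, deriv (fun s => c i s x) t * (z i * Φ t x)) t := by
  have hmain := hΩ.hasDerivAt_of_sub_eq_setIntegral
    (A := fun s => ∫ x in Ω, ‖gradient (Φ s) x‖ ^ 2) (w := Φ)
    (ρ := fun s x => 1 / ε * chargeDensity z c s x)
    (ρ' := fun s x => 1 / ε * ∑ i, z i * deriv (fun r => c i r x) s)
    (h.continuousOn_pot.mono (prod_mono Ioi_subset_Ici_self subset_rfl))
    (fun s hs => continuousOn_const.mul (h.continuousOn_charge (le_of_lt hs)))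
    (continuousOn_const.mul (continuousOn_finsetSum _ fun i _ =>
      continuousOn_const.mul (h.conc_time i).2))
    (fun s hs x hx => (HasDerivAt.fun_sum fun i _ =>
      (h.hasDerivAt_conc i s hs x hx).const_mul (z i)).const_mul _)
    ht (fun s hs => h.field_energy_sub hΩ hε hs ht)
  convert hmain using 1
  rw [← integral_finsetSum, ← integral_const_mul]
  · refine integral_congr_ae (Eventually.of_forall fun x => ?_)
    simp only [Finset.mul_sum]
    refine Finset.sum_congr rfl fun i _ => ?_
    ring
  · intro i _
    exact hΩ.integrableOn_of_continuousOn ((h.continuousOn_deriv_conc i ht).mul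
      (continuousOn_const.mul (h.contDiffOn_one_pot ht.le).continuousOn))

/-- The two contributions add up to `∂ₜcᵢ` tested with `ln cᵢ + zᵢΦ + K`, where `K = 1 - ln c̄ᵢ` is
invisible to the gradient after integration by parts. -/
lemma integral_deriv_conc_mul_potential (h : IsClassicalSolution Ω Dc z ε c Φ)
    (hΩ : IsSmoothBoundedDomain Ω) (i : Fin N) {t : ℝ} (ht : 0 < t) :
    (∫ x in Ω, deriv (fun s => c i s x) t * (Real.log (c i t x / initialMean Ω c i) + 1)) +
      ∫ x in Ω, deriv (fun s => c i s x) t * (z i * Φ t x) =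
    -(Dc i * ∫ x in Ω,
      c i t x * ‖gradient (fun y => Real.log (c i t y) + z i * Φ t y) x‖ ^ 2) := by
  have hm := h.initialMean_pos hΩ i
  have hc : ContinuousOn (c i t) (closure Ω) := (h.contDiffOn_conc i ht).continuousOn
  have hderiv := h.continuousOn_deriv_conc i ht
  have h1 : IntegrableOn (fun x => deriv (fun s => c i s x) t *
      (Real.log (c i t x / initialMean Ω c i) + 1)) Ω :=
    hΩ.integrableOn_of_continuousOn (hderiv.mul (((hc.div_const _).log fun x hx =>
      (div_pos (h.conc_pos i t ht x hx) hm).ne').add continuousOn_const))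
  have h2 : IntegrableOn (fun x => deriv (fun s => c i s x) t * (z i * Φ t x)) Ω :=
    hΩ.integrableOn_of_continuousOn (hderiv.mul
      (continuousOn_const.mul (h.contDiffOn_one_pot ht.le).continuousOn))
  rw [← integral_add h1 h2, ← mul_neg, ← integral_potential_mul_divergence_flux hΩ
    (h.contDiffOn_conc i ht) (h.conc_pos i t ht) (h.contDiffOn_pot ht) (h.conc_neumann i t ht)
    (h.pot_neumann t ht) (z i) (1 - Real.log (initialMean Ω c i)), ← integral_const_mul]
  refine setIntegral_congr_fun hΩ.isOpen.measurableSet fun x hx => ?_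
  have hpos := h.conc_pos i t ht x (subset_closure hx)
  simp only [h.deriv_conc_eq hΩ i ht hx, Real.log_div hpos.ne' hm.ne']
  ring

/-- The energy identity. -/
theorem hasDerivAt_energy (h : IsClassicalSolution Ω Dc z ε c Φ)
    (hΩ : IsSmoothBoundedDomain Ω) (hε : 0 < ε) {t : ℝ} (ht : 0 < t) :
    HasDerivAt (energy Ω ε c Φ) (-dissipation Ω Dc z c Φ t) t := by
  have hmain : HasDerivAt (energy Ω ε c Φ) _ t :=
    (HasDerivAt.fun_sum fun i _ => h.hasDerivAt_entropy hΩ i ht).add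
      ((h.hasDerivAt_field_energy hΩ hε ht).const_mul (ε / 2))
  convert hmain using 1
  rw [← mul_assoc, show ε / 2 * (2 / ε) = 1 by field_simp, one_mul, ← Finset.sum_add_distrib,
    dissipation, ← Finset.sum_neg_distrib]
  exact Finset.sum_congr rfl fun i _ => (h.integral_deriv_conc_mul_potential hΩ i ht).symm

/-! ### Comparison of the two dissipations. -/

theorem reducedDissipation_le_dissipation (h : IsClassicalSolution Ω Dc z ε c Φ)
    (hΩ : IsSmoothBoundedDomain Ω) (hε : 0 < ε) {t : ℝ} (ht : 0 < t) :
    reducedDissipation Ω Dc z ε c Φ t ≤ dissipation Ω Dc z c Φ t := by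
  have hρ := h.continuousOn_charge ht.le
  have hcρ : ∀ i, IntegrableOn (fun x => 2 * z i * (c i t x *
      (1 / ε * chargeDensity z c t x))) Ω := fun i =>
    hΩ.integrableOn_of_continuousOn (continuousOn_const.mul
      ((h.contDiffOn_conc i ht).continuousOn.mul (continuousOn_const.mul hρ)))
  have hcΦ : ∀ i, IntegrableOn (fun x => z i ^ 2 * c i t x * ‖gradient (Φ t) x‖ ^ 2) Ω := fun i =>
    hΩ.integrableOn_mul_norm_gradient_sq
      (continuousOn_const.mul (h.contDiffOn_conc i ht).continuousOn) (h.contDiffOn_one_pot ht.le)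
  -- An identity: without the diffusivities the two dissipations coincide. The inequality comes only
  -- from `⨅ i, Dc i ≤ Dc i` and nonnegativity of each species' integral.
  have hsum : ((∑ i, ∫ x in Ω, 4 * ‖gradient (fun y => Real.sqrt (c i t y)) x‖ ^ 2) +
      ∫ x in Ω, (2 / ε * chargeDensity z c t x ^ 2 +
        ∑ i, z i ^ 2 * c i t x * ‖gradient (Φ t) x‖ ^ 2)) =
      ∑ i, ∫ x in Ω, c i t x *
        ‖gradient (fun y => Real.log (c i t y) + z i * Φ t y) x‖ ^ 2 := by
    have hint : ∫ x in Ω, (2 / ε * chargeDensity z c t x ^ 2 +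
        ∑ i, z i ^ 2 * c i t x * ‖gradient (Φ t) x‖ ^ 2) =
        ∑ i, ((2 * z i * ∫ x in Ω, c i t x * (1 / ε * chargeDensity z c t x)) +
          ∫ x in Ω, z i ^ 2 * c i t x * ‖gradient (Φ t) x‖ ^ 2) := by
      simp only [← integral_const_mul]
      rw [Finset.sum_add_distrib, ← integral_finsetSum _ fun i _ => hcρ i,
        ← integral_finsetSum _ fun i _ => hcΦ i,
        ← integral_add (integrable_finsetSum _ fun i _ => hcρ i)
          (integrable_finsetSum _ fun i _ => hcΦ i)]
      refine integral_congr_ae (Eventually.of_forall fun x => ?_)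
      simp only
      congr 1
      -- Expanding one factor of `ρ²` distributes it over the species, matching the mixed terms `2
      -- zᵢ ∫ ∇cᵢ·∇Φ = (2 / ε) ∫ zᵢ cᵢ ρ`.
      have : chargeDensity z c t x ^ 2 = ∑ i, z i * c i t x * chargeDensity z c t x := by
        rw [sq, ← Finset.sum_mul]; rfl
      rw [this, Finset.mul_sum]
      refine Finset.sum_congr rfl fun i _ => ?_
      ring
    rw [hint, ← Finset.sum_add_distrib]
    refine Finset.sum_congr rfl fun i _ => ?_
    rw [integral_mul_norm_gradient_log_add_sq hΩ (h.contDiffOn_conc i ht) (h.conc_pos i t ht)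
      (h.contDiffOn_pot ht) (z i), h.integral_inner_gradient_pot hΩ hε ht
      ((h.contDiffOn_conc i ht).of_le (by norm_num))]
    ring
  rw [reducedDissipation, hsum, dissipation, Finset.mul_sum]
  refine Finset.sum_le_sum fun i _ => mul_le_mul_of_nonneg_right
    (ciInf_le (Finite.bddBelow_range Dc) i) ?_
  exact setIntegral_nonneg hΩ.isOpen.measurableSet fun x hx =>
    mul_nonneg (h.conc_pos i t ht x (subset_closure hx)).le (sq_nonneg _)

end IsClassicalSolution

end NernstPlanckPoisson

end

/-! ### Integrability, continuity and energy law assembled. -/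

theorem proposition4p1 {d N : ℕ} (hd : 2 ≤ d) (hN : 1 ≤ N)
    (Ω : Set (EuclideanSpace ℝ (Fin d)))
    (hΩ : NernstPlanckPoisson.IsSmoothBoundedDomain Ω)
    (Dc z : Fin N → ℝ) (hD : ∀ i, 0 < Dc i) (ε : ℝ) (hε : 0 < ε)
    (c : Fin N → ℝ → EuclideanSpace ℝ (Fin d) → ℝ)
    (Φ : ℝ → EuclideanSpace ℝ (Fin d) → ℝ)
    (hsol : NernstPlanckPoisson.IsClassicalSolution Ω Dc z ε c Φ)
    (hneutral : ∑ i, z i * NernstPlanckPoisson.initialMean Ω c i = 0) :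
    -- all integrals occurring below converge
    ((∀ t, 0 ≤ t → ∀ i, IntegrableOn (fun x => c i t x *
          Real.log (c i t x / NernstPlanckPoisson.initialMean Ω c i)) Ω) ∧
      (∀ t, 0 ≤ t → IntegrableOn (fun x => ‖gradient (Φ t) x‖ ^ 2) Ω) ∧
      (∀ t, 0 < t → ∀ i, IntegrableOn (fun x => c i t x *
          ‖gradient (fun y => Real.log (c i t y) + z i * Φ t y) x‖ ^ 2) Ω) ∧
      (∀ t, 0 < t → ∀ i, IntegrableOn (fun x =>
          ‖gradient (fun y => Real.sqrt (c i t y)) x‖ ^ 2) Ω) ∧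
      (∀ t, 0 < t → IntegrableOn (fun x =>
          NernstPlanckPoisson.chargeDensity z c t x ^ 2) Ω) ∧
      (∀ t, 0 < t → ∀ i, IntegrableOn (fun x =>
          c i t x * ‖gradient (Φ t) x‖ ^ 2) Ω)) ∧
    -- the energy is continuous up to the initial time
    ContinuousOn (NernstPlanckPoisson.energy Ω ε c Φ) (Ici 0) ∧
    -- the energy identity and the energy inequality
    ∀ t, 0 < t → ∃ E' : ℝ,
      HasDerivAt (NernstPlanckPoisson.energy Ω ε c Φ) E' t ∧
      E' + NernstPlanckPoisson.dissipation Ω Dc z c Φ t = 0 ∧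
      E' + NernstPlanckPoisson.reducedDissipation Ω Dc z ε c Φ t ≤ 0 := by
  refine ⟨⟨fun t ht i => ?_, fun t ht => ?_, fun t ht i => ?_, fun t ht i => ?_, fun t ht => ?_,
    fun t ht i => ?_⟩, hsol.continuousOn_energy hΩ, fun t ht => ?_⟩
  · exact hΩ.integrableOn_of_continuousOn
      (NernstPlanckPoisson.continuousOn_slice (f := fun t x => c i t x *
        Real.log (c i t x / NernstPlanckPoisson.initialMean Ω c i)) (hsol.continuousOn_entropy hΩ i) ht)
  · simpa using hΩ.integrableOn_mul_norm_gradient_sq (f := fun _ => 1) continuousOn_const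
      (hsol.contDiffOn_one_pot ht)
  · exact NernstPlanckPoisson.integrableOn_mul_norm_gradient_log_add_sq hΩ
      (hsol.contDiffOn_conc i ht) (hsol.conc_pos i t ht) (hsol.contDiffOn_pot ht) (z i)
  · exact NernstPlanckPoisson.integrableOn_norm_gradient_sqrt_sq hΩ
      (hsol.contDiffOn_conc i ht) (hsol.conc_pos i t ht)
  · exact hΩ.integrableOn_of_continuousOn ((hsol.continuousOn_charge ht.le).pow 2)
  · exact hΩ.integrableOn_mul_norm_gradient_sq (hsol.contDiffOn_conc i ht).continuousOn
      (hsol.contDiffOn_one_pot ht.le)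
  · refine ⟨_, hsol.hasDerivAt_energy hΩ hε ht, neg_add_cancel _, ?_⟩
    have := hsol.reducedDissipation_le_dissipation hΩ hε ht
    linarith
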